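/- Let $A=(b_n)_{n\ge 1}$ be a sequence of integers $b_n\ge 2$. Assume that for every $k$ the limit $d_k=\lim_{n\to\infty}\frac1n\,\mathrm{card}\{1\le i\le n: b_i=k\}$ exists, that $\sum_{n\ge 2}d_n=1$, that $\sum_{n\ge2}d_n\log n<\infty$, and that $\lim_{n\to\infty}\frac1n\sum_{i=1}^n\log b_i=\sum_{n\ge 2}d_n\log n$. Let $\alpha=(\alpha_j)_{j\ge0}$ be a stochastic vector, i.e. $\alpha_j\ge0$ and $\sum_{j\ge0}\alpha_j=1$. Let $J_A(\alpha)$ be the set of all $x\in[0,1]$ having a Cantor series expansion $x=\sum_{n\ge1}\frac{\epsilon_n}{b_1b_2\cdots b_n}$, $\epsilon_n\in\{0,\dots,b_n-1\}$ (unique except for countably many $x$), such that $\lim_{n\to\infty}\frac1n\,\mathrm{card}\{1\le k\le n:\epsilon_k=j\}=\alpha_j$ for every $j\ge0$. Assume that $\alpha$ is compatible with $d$: there are numbers $p_{n,j}\ge0$ ($n\ge2$, $0\le j<n$) with $\sum_{j=0}^{n-1}p_{n,j}=1$ for every $n\ge 2$ and $\sum_{n\ge 2,\;n>j}d_np_{n,j}=\alpha_j$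 for every $j\ge 0$. Put $j_0=\min\{j:\alpha_j\ne0\}$, $d_1=0$ and $$A_n=\sum_{j=j_0}^{n-1}\alpha_j-\sum_{k=j_0+1}^{n-1}d_k,\qquad r_n=\frac1{A_n}\prod_{k=j_0+1}^{n-1}\Big(1-\frac{d_k}{A_k}\Big),\qquad t_j=\frac{\alpha_j}{\prod_{k=j_0+1}^{j}\big(1-\frac{d_k}{A_k}\big)}.$$ Assume that $t_j$ is defined whenever $\alpha_j\neq0$, i.e. that $A_k\ne0$ and $A_k\ne d_k$ whenever $j_0<k\le j$ and $\alpha_j\ne0$, and that the series $\sum_{j\ge j_0}\alpha_j\log t_j$ converges, where terms with $\alpha_j=0$ are read as $0$. Then the series $\sum_{i\ge j_0+1}d_i\log r_i$ (terms with $d_i=0$ are read as $0$) also converges, and $$\dim_H J_A(\alpha)=-\,\frac{\sum_{j=j_0}^{\infty}\alpha_j\log t_j+\sum_{i=j_0+1}^{\infty}d_i\log r_i}{\sum_{n=2}^{\infty}d_n\log n}.$$ -/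

import Mathlib

open Filter Topology

noncomputable section

namespace CantorSeries

/-- `D_k(n)`: the number of `k`'s among the first `n` bases. The sequence `b_1, b_2, …` is indexed
from `0` in the code, so `b i` stands for `b_{i+1}`. -/
def baseCount (b : ℕ → ℕ) (k n : ℕ) : ℕ :=
  ((Finset.range n).filter (fun i => b i = k)).card

/-- `d_k = lim D_k(n) / n` for every `k` (in particular, all these limits exist). -/
def IsBaseFrequency (b : ℕ → ℕ) (d : ℕ → ℝ) : Prop :=
  ∀ k, Tendsto (fun n : ℕ => (baseCount b k n : ℝ) / n) atTop (𝓝 (d k))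

/-- `ε` is a sequence of digits of the Cantor series of `x` with respect to the base `b`. -/
def IsExpansion (b : ℕ → ℕ) (ε : ℕ → ℕ) (x : ℝ) : Prop :=
  (∀ i, ε i < b i) ∧
    HasSum (fun i => (ε i : ℝ) / ∏ k ∈ Finset.range (i + 1), (b k : ℝ)) x

/-- `τ_j(x, n)`: the number of `j`'s among the first `n` digits. -/
def digitCount (ε : ℕ → ℕ) (j n : ℕ) : ℕ :=
  ((Finset.range n).filter (fun i => ε i = j)).card

/-- `J_A(α)`: the points of `[0,1]` in whose Cantor series every digit `j` has frequency `α j`.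
The countably many points with two expansions are included when one of the two qualifies. -/
def levelSet (b : ℕ → ℕ) (α : ℕ → ℝ) : Set ℝ :=
  {x | x ∈ Set.Icc (0 : ℝ) 1 ∧ ∃ ε : ℕ → ℕ, IsExpansion b ε x ∧
    ∀ j, Tendsto (fun n : ℕ => (digitCount ε j n : ℝ) / n) atTop (𝓝 (α j))}

/-- A stochastic vector indexed by `0, 1, 2, …`. -/
def IsStochastic (α : ℕ → ℝ) : Prop :=
  (∀ j, 0 ≤ α j) ∧ HasSum α 1

/-- The arrays `p n j`, `n ≥ 2`, `0 ≤ j < n`, whose rows are probability vectors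
(extended by `0` to `j ≥ n`; the rows `n = 0, 1` play no role). -/
def tables : Set (ℕ → ℕ → ℝ) :=
  {p | ∀ n, 2 ≤ n →
    (∀ j, 0 ≤ p n j) ∧ (∀ j, n ≤ j → p n j = 0) ∧ ∑ j ∈ Finset.range n, p n j = 1}

/-- `π(α)`: the arrays with `α_j = ∑_n d_n p_{n,j}` for every `j`. -/
def tablesWith (d α : ℕ → ℝ) : Set (ℕ → ℕ → ℝ) :=
  {p | p ∈ tables ∧ ∀ j, HasSum (fun n => d n * p n j) (α j)}

/-- `j₀ = min {j : α_j ≠ 0}`. -/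
def firstIndex (α : ℕ → ℝ) : ℕ := sInf {j | α j ≠ 0}

/-- `A_n = ∑_{j=j₀}^{n-1} α_j - ∑_{k=j₀+1}^{n-1} d_k`. -/
def seqA (d α : ℕ → ℝ) (n : ℕ) : ℝ :=
  ∑ j ∈ Finset.Ico (firstIndex α) n, α j - ∑ k ∈ Finset.Ico (firstIndex α + 1) n, d k

/-- `r_n = (1 / A_n) ∏_{k=j₀+1}^{n-1} (1 - d_k / A_k)`. -/
def seqR (d α : ℕ → ℝ) (n : ℕ) : ℝ :=
  1 / seqA d α n * ∏ k ∈ Finset.Ico (firstIndex α + 1) n, (1 - d k / seqA d α k)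

/-- `t_j = α_j / ∏_{k=j₀+1}^{j} (1 - d_k / A_k)`. -/
def seqT (d α : ℕ → ℝ) (j : ℕ) : ℝ :=
  α j / ∏ k ∈ Finset.Icc (firstIndex α + 1) j, (1 - d k / seqA d α k)

end CantorSeries

end

/-!
The weights `t j` and `r n` are chosen such that the numbers `p n j = t j * r n`, `j < n`, form a
table compatible with `d` and `α`. Draw the digits independently, the one in the base `n` according
to the row `p n`. By the strong law of large numbers almost every digit sequence has the frequencies
`α`, and the mass of its cylinder of length `m` is at most about `exp (-m h)`, where
`h = -∑ α j log (t j) - ∑ d n log (r n)` is the mean entropy of the rows; since the cylinder has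
length about `exp (-m L)` with `L = ∑ d n log n`, the dimension is at least `h / L`.

Conversely, let the digit `j` in the base `n` cost `-log (t j) - log (r n)`. As `p n` is a
probability vector, there are at most `exp c` cylinders of a given length whose total cost is at
most `c`. The cost separates into a function of the digit and a function of the base, hence its mean
is `h` along *every* digit sequence with the frequencies `α`, and covering by cheap cylinders gives
the bound `h / L` from above. Frequencies do not control the mean of an unbounded cost: therefore
only the bases below some `N` are charged in this way, the others cost `log n`, and `N → ∞`.
-/

noncomputable section

namespace CantorSeries

open Finset MeasureTheory ProbabilityTheory

variable {ι κ S : Type*}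

/-! ### Asymptotic frequencies -/

/-- Every symbol `k` occurs in the sequence `u` with asymptotic frequency `f k`. Both
`IsBaseFrequency b d` and the condition on the digits in `levelSet` unfold to this notion. -/
def HasFrequencies [DecidableEq ι] (u : ℕ → ι) (f : ι → ℝ) : Prop :=
  ∀ k, Tendsto (fun n : ℕ => (((range n).filter (fun i => u i = k)).card : ℝ) / n) atTop (𝓝 (f k))

namespace HasFrequencies

variable [DecidableEq ι] {u : ℕ → ι} {f : ι → ℝ}

lemma nonneg (h : HasFrequencies u f) (k : ι) : 0 ≤ f k :=
  ge_of_tendsto' (h k) fun n => by positivity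

lemma eq_zero_of_forall_ne (h : HasFrequencies u f) {k : ι} (hk : ∀ i, u i ≠ k) : f k = 0 := by
  refine tendsto_nhds_unique (h k) (tendsto_const_nhds.congr fun n => ?_)
  simp [hk]

lemma tendsto_average (h : HasFrequencies u f) (K : Finset ι) (g : ι → ℝ) :
    Tendsto (fun n : ℕ => (∑ i ∈ range n, if u i ∈ K then g (u i) else 0) / n) atTop
      (𝓝 (∑ k ∈ K, f k * g k)) := by
  refine (tendsto_finsetSum K fun k _ => (h k).mul_const (g k)).congr fun n => ?_
  simp_rw [← sum_ite_eq K _ g]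
  rw [sum_comm, sum_div]
  refine sum_congr rfl fun k _ => ?_
  rw [← sum_filter, sum_const, nsmul_eq_mul, div_mul_eq_mul_div]

lemma tendsto_notMem (h : HasFrequencies u f) (K : Finset ι) :
    Tendsto (fun n : ℕ => (((range n).filter (fun i => u i ∉ K)).card : ℝ) / n) atTop
      (𝓝 (1 - ∑ k ∈ K, f k)) := by
  have hK := h.tendsto_average K fun _ => 1
  simp only [mul_one, sum_boole] at hK
  refine (hK.const_sub 1).congr' ?_
  filter_upwards [eventually_ne_atTop 0] with n hn
  have hcard := card_filter_add_card_filter_not (s := range n) (fun i => u i ∈ K)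
  rw [card_range] at hcard
  have hn' : (n : ℝ) ≠ 0 := by exact_mod_cast hn
  rw [eq_div_iff hn', sub_mul, div_mul_cancel₀ _ hn', one_mul, sub_eq_iff_eq_add']
  exact_mod_cast hcard.symm

lemma sum_le_one (h : HasFrequencies u f) (K : Finset ι) : ∑ k ∈ K, f k ≤ 1 :=
  sub_nonneg.1 (ge_of_tendsto' (h.tendsto_notMem K) fun n => by positivity)

end HasFrequencies

lemma tendsto_of_approx {X A B : Type*} [PseudoMetricSpace X] {la : Filter A} {lb : Filter B}
    [lb.NeBot] {x : A → X} {y : B → A → X} {w : B → A → ℝ} {Y : B → X} {W : B → ℝ} {l : X}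
    (hxy : ∀ N, ∀ᶠ n in la, dist (x n) (y N n) ≤ w N n) (hy : ∀ N, Tendsto (y N) la (𝓝 (Y N)))
    (hw : ∀ N, Tendsto (w N) la (𝓝 (W N))) (hY : Tendsto Y lb (𝓝 l)) (hW : Tendsto W lb (𝓝 0)) :
    Tendsto x la (𝓝 l) := by
  refine Metric.tendsto_nhds.2 fun e he => ?_
  obtain ⟨N, hYN, hWN⟩ := ((Metric.tendsto_nhds.1 hY (e / 3) (by positivity)).and
    (hW.eventually_lt_const (show 0 < e / 3 by positivity))).exists
  filter_upwards [hxy N, Metric.tendsto_nhds.1 (hy N) (e / 3) (by positivity),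
    (hw N).eventually_lt_const hWN] with n hx hyn hwn
  linarith [dist_triangle4 (x n) (y N n) (Y N) l]

/-- Frequencies of total mass one do not escape to infinity, so they can be summed over the
fibres of a map. -/
lemma HasFrequencies.map [DecidableEq ι] [DecidableEq κ] {u : ℕ → ι} {f : ι → ℝ}
    (h : HasFrequencies u f) (hf : HasSum f 1) {φ : ι → κ} {g : κ → ℝ}
    (hg : ∀ y, HasSum (fun k => if φ k = y then f k else 0) (g y)) :
    HasFrequencies (fun i => φ (u i)) g := by
  intro y
  refine tendsto_of_approx (lb := (atTop : Filter (Finset ι)))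
    (fun K => .of_forall fun n => ?_)
    (fun K => h.tendsto_average K fun k => if φ k = y then 1 else 0)
    h.tendsto_notMem ?_ ?_
  · rw [Real.dist_eq, ← sub_div, abs_div, Nat.abs_cast, ← sum_boole, ← sum_boole,
      ← sum_sub_distrib]
    gcongr
    refine (abs_sum_le_sum_abs _ _).trans (sum_le_sum fun i _ => ?_)
    split_ifs <;> simp_all
  · simp only [mul_ite, mul_one, mul_zero]
    exact hg y
  · simpa using (hf : Tendsto _ _ _).const_sub 1

/-! ### Basic intervals of a Cantor series -/

/-- The integer whose mixed radix digits with respect to `b` are `ε 0, …, ε (n - 1)`, the most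
significant digit first. -/
def radixValue (b ε : ℕ → ℕ) : ℕ → ℕ
  | 0 => 0
  | n + 1 => b n * radixValue b ε n + ε n

/-- The product `b_1 ⋯ b_n` of the first `n` bases, as a real number. -/
def baseProd (b : ℕ → ℕ) (n : ℕ) : ℝ := ∏ k ∈ range n, (b k : ℝ)

section Expansion

variable {b ε ε' : ℕ → ℕ} {x y : ℝ}

lemma radixValue_congr {n : ℕ} (h : ∀ i < n, ε i = ε' i) :
    radixValue b ε n = radixValue b ε' n := by
  induction n with
  | zero => rfl
  | succ n ih => rw [radixValue, radixValue, ih fun i hi => h i (by omega), h n (by omega)]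

lemma eq_of_radixValue_eq (h : ∀ i, ε i < b i) (h' : ∀ i, ε' i < b i) {n : ℕ}
    (heq : radixValue b ε n = radixValue b ε' n) : ∀ i < n, ε i = ε' i := by
  induction n with
  | zero => simp
  | succ n ih =>
    simp only [radixValue] at heq
    have hlast : ε n = ε' n := by
      have := congrArg (· % b n) heq
      simpa [Nat.mul_add_mod, Nat.mod_eq_of_lt (h n), Nat.mod_eq_of_lt (h' n)] using this
    rw [hlast, Nat.add_right_cancel_iff] at heq
    have hinit := ih (Nat.eq_of_mul_eq_mul_left ((Nat.zero_le _).trans_lt (h n)) heq)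
    exact fun i hi => (Nat.lt_succ_iff_lt_or_eq.1 hi).elim (hinit i) fun hin => hin ▸ hlast

lemma baseProd_succ (b : ℕ → ℕ) (n : ℕ) : baseProd b (n + 1) = baseProd b n * b n :=
  prod_range_succ _ _

lemma baseProd_pos (hb : ∀ i, 0 < b i) (n : ℕ) : 0 < baseProd b n :=
  prod_pos fun i _ => Nat.cast_pos.2 (hb i)

lemma log_baseProd (hb : ∀ i, 0 < b i) (n : ℕ) :
    Real.log (baseProd b n) = ∑ i ∈ range n, Real.log (b i) :=
  Real.log_prod fun i _ => Nat.cast_ne_zero.2 (hb i).ne'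

lemma tendsto_baseProd_atTop (hb : ∀ i, 0 < b i) {L : ℝ} (hL0 : 0 < L)
    (hL : Tendsto (fun n : ℕ => (∑ i ∈ range n, Real.log (b i)) / n) atTop (𝓝 L)) :
    Tendsto (baseProd b) atTop atTop := by
  have hlog : Tendsto (fun n => Real.log (baseProd b n)) atTop atTop := by
    refine (hL.pos_mul_atTop hL0 tendsto_natCast_atTop_atTop).congr' ?_
    filter_upwards [eventually_ne_atTop 0] with n hn
    rw [log_baseProd hb, div_mul_cancel₀ _ (Nat.cast_ne_zero.2 hn)]
  exact (Real.tendsto_exp_atTop.comp hlog).congr fun n => Real.exp_log (baseProd_pos hb n)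

lemma sum_range_eq_radixValue_div (hb : ∀ i, 0 < b i) (ε : ℕ → ℕ) (n : ℕ) :
    ∑ i ∈ range n, (ε i : ℝ) / ∏ k ∈ range (i + 1), (b k : ℝ) =
      radixValue b ε n / baseProd b n := by
  induction n with
  | zero => simp [radixValue]
  | succ n ih =>
    have hprod := (baseProd_pos hb n).ne'
    have hbase : (b n : ℝ) ≠ 0 := Nat.cast_ne_zero.2 (hb n).ne'
    rw [sum_range_succ, ih, ← baseProd, baseProd_succ, radixValue]
    push_cast
    field_simp

lemma antitone_radixValue_add_one_div (h : ∀ i, ε i < b i) :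
    Antitone fun n => ((radixValue b ε n : ℝ) + 1) / baseProd b n := by
  refine antitone_nat_of_succ_le fun n => ?_
  have hb : ∀ i, 0 < b i := fun i => (Nat.zero_le _).trans_lt (h i)
  have hprod := baseProd_pos hb n
  have hdigit : (ε n : ℝ) + 1 ≤ b n := by exact_mod_cast h n
  rw [div_le_div_iff₀ (baseProd_pos hb _) hprod, baseProd_succ, radixValue]
  push_cast
  nlinarith [mul_le_mul_of_nonneg_left hdigit hprod.le]

lemma sum_range_le (h : ∀ i, ε i < b i) {m n : ℕ} (hmn : n ≤ m) :
    ∑ i ∈ range m, (ε i : ℝ) / ∏ k ∈ range (i + 1), (b k : ℝ) ≤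
      ((radixValue b ε n : ℝ) + 1) / baseProd b n := by
  have hb : ∀ i, 0 < b i := fun i => (Nat.zero_le _).trans_lt (h i)
  rw [sum_range_eq_radixValue_div hb]
  refine le_trans ?_ (antitone_radixValue_add_one_div h hmn)
  exact div_le_div_of_nonneg_right (by linarith) (baseProd_pos hb m).le

lemma summable_expansion (h : ∀ i, ε i < b i) :
    Summable fun i => (ε i : ℝ) / ∏ k ∈ range (i + 1), (b k : ℝ) :=
  summable_of_sum_range_le (fun i => by positivity) fun m => sum_range_le h (Nat.zero_le m)

lemma IsExpansion.base_pos (hx : IsExpansion b ε x) (i : ℕ) : 0 < b i :=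
  (Nat.zero_le _).trans_lt (hx.1 i)

lemma IsExpansion.radixValue_div_le (hx : IsExpansion b ε x) (n : ℕ) :
    (radixValue b ε n : ℝ) / baseProd b n ≤ x := by
  rw [← sum_range_eq_radixValue_div hx.base_pos]
  exact sum_le_hasSum _ (fun i _ => by positivity) hx.2

lemma IsExpansion.le_radixValue_add_one_div (hx : IsExpansion b ε x) (n : ℕ) :
    x ≤ ((radixValue b ε n : ℝ) + 1) / baseProd b n :=
  le_of_tendsto hx.2.tendsto_sum_nat
    (eventually_atTop.2 ⟨n, fun _ hm => sum_range_le hx.1 hm⟩)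

lemma IsExpansion.mem_Icc (hx : IsExpansion b ε x) : x ∈ Set.Icc (0 : ℝ) 1 := by
  simpa [radixValue, baseProd] using
    And.intro (hx.radixValue_div_le 0) (hx.le_radixValue_add_one_div 0)

lemma IsExpansion.abs_sub_le (hx : IsExpansion b ε x) (hy : IsExpansion b ε' y) {n : ℕ}
    (h : ∀ i < n, ε i = ε' i) : |x - y| ≤ (baseProd b n)⁻¹ := by
  have hxl := hx.radixValue_div_le n
  have hxu := hx.le_radixValue_add_one_div n
  have hyl := hy.radixValue_div_le n
  have hyu := hy.le_radixValue_add_one_div n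
  rw [radixValue_congr h] at hxl hxu
  rw [add_div, one_div] at hxu hyu
  rw [_root_.abs_sub_le_iff]
  constructor <;> linarith

end Expansion

/-! ### Upper bounds for the dimension from digit costs -/

lemma dimH_le_of_cover {X : Type*} [EMetricSpace X] [MeasurableSpace X] [BorelSpace X] {E : Set X}
    {I : ℕ → Type*} [∀ n, Fintype (I n)] {t : ∀ n, I n → Set X} {δ : ℕ → ENNReal}
    (hδ : Tendsto δ atTop (𝓝 0)) (hdiam : ∀ n i, Metric.ediam (t n i) ≤ δ n)
    (hcov : ∀ᶠ n in atTop, E ⊆ ⋃ i, t n i) {s : NNReal} {C : ENNReal} (hC : C ≠ ⊤)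
    (hcard : ∀ᶠ n in atTop, Fintype.card (I n) * δ n ^ (s : ℝ) ≤ C) : dimH E ≤ s := by
  refine dimH_le_of_hausdorffMeasure_ne_top (ne_top_of_le_ne_top hC ?_)
  refine (Measure.hausdorffMeasure_le_liminf_sum (s : ℝ) E δ hδ t (.of_forall hdiam) hcov).trans
    (liminf_le_of_frequently_le' (hcard.mono fun n hn => le_trans ?_ hn).frequently)
  refine (sum_le_card_nsmul univ _ (δ n ^ (s : ℝ)) fun i _ => ?_).trans_eq (nsmul_eq_mul _ _)
  exact ENNReal.rpow_le_rpow (hdiam n i) s.2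

/-- Chernoff's argument: each counted word contributes at least `exp (-c)` to the product of the
sums `∑ j ∈ A i, exp (-Ψ i j)`. -/
lemma card_filter_sum_le [Fintype ι] [DecidableEq ι] {A : ι → Finset κ} {Ψ : ι → κ → ℝ} {η : ℝ}
    (hΨ : ∀ i, ∑ j ∈ A i, Real.exp (-Ψ i j) ≤ Real.exp η) (c : ℝ) :
    (((Fintype.piFinset A).filter fun w => ∑ i, Ψ i (w i) ≤ c).card : ℝ) ≤
      Real.exp (c + Fintype.card ι * η) := by
  set W := (Fintype.piFinset A).filter fun w => ∑ i, Ψ i (w i) ≤ c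
  have hsum : W.card * Real.exp (-c) ≤ Real.exp (Fintype.card ι * η) :=
    calc W.card * Real.exp (-c) = ∑ _w ∈ W, Real.exp (-c) := by rw [sum_const, nsmul_eq_mul]
      _ ≤ ∑ w ∈ W, ∏ i, Real.exp (-Ψ i (w i)) := sum_le_sum fun w hw => by
          rw [← Real.exp_sum, sum_neg_distrib]
          exact Real.exp_le_exp.2 (neg_le_neg (mem_filter.1 hw).2)
      _ ≤ ∑ w ∈ Fintype.piFinset A, ∏ i, Real.exp (-Ψ i (w i)) :=
          sum_le_sum_of_subset_of_nonneg (filter_subset _ _) fun w _ _ => by positivity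
      _ = ∏ i, ∑ j ∈ A i, Real.exp (-Ψ i j) := (prod_univ_sum A fun i j => Real.exp (-Ψ i j)).symm
      _ ≤ ∏ _i : ι, Real.exp η := prod_le_prod (fun i _ => by positivity) fun i _ => hΨ i
      _ = Real.exp (Fintype.card ι * η) := by rw [prod_const, card_univ, Real.exp_nat_mul]
  rwa [Real.exp_neg, ← div_eq_mul_inv, div_le_iff₀ (Real.exp_pos _), ← Real.exp_add,
    add_comm] at hsum

section Cost

variable {b : ℕ → ℕ} {L c η : ℝ} {Ψ : ℕ → ℕ → ℝ} {E : Set (ℕ → ℕ)}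

lemma eventually_exp_mul_rpow_inv_baseProd_le_one (hb : ∀ i, 0 < b i)
    (hL : Tendsto (fun n : ℕ => (∑ i ∈ range n, Real.log (b i)) / n) atTop (𝓝 L)) {a s : ℝ}
    (hs : a < s * L) :
    ∀ᶠ n : ℕ in atTop, Real.exp (n * a) * (baseProd b n)⁻¹ ^ s ≤ 1 := by
  filter_upwards [(hL.const_mul s).eventually_const_lt hs, eventually_gt_atTop 0] with n hn hn0
  rw [← log_baseProd hb, ← mul_div_assoc, lt_div_iff₀ (Nat.cast_pos.2 hn0)] at hn
  rw [Real.rpow_def_of_pos (inv_pos.2 (baseProd_pos hb n)), Real.log_inv, ← Real.exp_add,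
    Real.exp_le_one_iff]
  linarith

lemma dimH_le_of_forall_cost (hb : ∀ i, 0 < b i) (hL0 : 0 < L)
    (hL : Tendsto (fun n : ℕ => (∑ i ∈ range n, Real.log (b i)) / n) atTop (𝓝 L))
    (hΨ : ∀ i, ∑ j ∈ range (b i), Real.exp (-Ψ i j) ≤ Real.exp η) {s : NNReal}
    (hs : c + η < s * L) {m : ℕ}
    (hE : ∀ ε ∈ E, ∀ n ≥ m, ∑ i ∈ range n, Ψ i (ε i) ≤ n * c) :
    dimH {x : ℝ | ∃ ε ∈ E, IsExpansion b ε x} ≤ s := by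
  let W (n : ℕ) : Finset (Fin n → ℕ) := (Fintype.piFinset fun i : Fin n => range (b i)).filter
    fun w => ∑ i : Fin n, Ψ i (w i) ≤ n * c
  refine dimH_le_of_cover (I := fun n => W n) (δ := fun n => ENNReal.ofReal (baseProd b n)⁻¹)
    (t := fun n w => {x | ∃ ε, (∀ i : Fin n, ε i = w.1 i) ∧ IsExpansion b ε x})
    ?_ (fun n w => Metric.ediam_le ?_) ?_ ENNReal.one_ne_top ?_
  · simpa using ENNReal.tendsto_ofReal (tendsto_baseProd_atTop hb hL0 hL).inv_tendsto_atTop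
  · rintro x ⟨ε, hε, hx⟩ y ⟨ε', hε', hy⟩
    rw [edist_dist]
    exact ENNReal.ofReal_le_ofReal
      (hx.abs_sub_le hy fun i hi => (hε ⟨i, hi⟩).trans (hε' ⟨i, hi⟩).symm)
  · filter_upwards [eventually_ge_atTop m] with n hn
    rintro x ⟨ε, hεE, hx⟩
    refine Set.mem_iUnion.2 ⟨⟨fun i : Fin n => ε i, mem_filter.2
      ⟨Fintype.mem_piFinset.2 fun i => mem_range.2 (hx.1 i), ?_⟩⟩, ε, fun _ => rfl, hx⟩
    rw [Fin.sum_univ_eq_sum_range (fun i => Ψ i (ε i))]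
    exact hE ε hεE n hn
  · filter_upwards [eventually_exp_mul_rpow_inv_baseProd_le_one hb hL hs] with n hn
    have hpos := inv_pos.2 (baseProd_pos hb n)
    rw [ENNReal.ofReal_rpow_of_pos hpos, Fintype.card_coe, ← ENNReal.ofReal_natCast,
      ← ENNReal.ofReal_mul (by positivity), ENNReal.ofReal_le_one]
    refine (mul_le_mul_of_nonneg_right ?_ (Real.rpow_nonneg hpos.le _)).trans hn
    simpa only [Fintype.card_fin, mul_add] using
      card_filter_sum_le (fun i : Fin n => hΨ i) (n * c)

theorem dimH_le_of_cost (hb : ∀ i, 0 < b i) (hL0 : 0 < L)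
    (hL : Tendsto (fun n : ℕ => (∑ i ∈ range n, Real.log (b i)) / n) atTop (𝓝 L))
    (hΨ : ∀ i, ∑ j ∈ range (b i), Real.exp (-Ψ i j) ≤ Real.exp η)
    (hE : ∀ ε ∈ E, ∀ᶠ n : ℕ in atTop, ∑ i ∈ range n, Ψ i (ε i) ≤ n * c) :
    dimH {x : ℝ | ∃ ε ∈ E, IsExpansion b ε x} ≤ ENNReal.ofReal ((c + η) / L) := by
  let T (m : ℕ) : Set (ℕ → ℕ) := {ε | ∀ n ≥ m, ∑ i ∈ range n, Ψ i (ε i) ≤ n * c}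
  have hsub : {x : ℝ | ∃ ε ∈ E, IsExpansion b ε x} ⊆ ⋃ m, {x | ∃ ε ∈ T m, IsExpansion b ε x} := by
    rintro x ⟨ε, hε, hx⟩
    obtain ⟨m, hm⟩ := eventually_atTop.1 (hE ε hε)
    exact Set.mem_iUnion.2 ⟨m, ε, hm, hx⟩
  refine (dimH_mono hsub).trans ((dimH_iUnion _).trans_le (iSup_le fun m => ?_))
  refine le_of_forall_gt fun a ha => ?_
  obtain ⟨s, hs, hsa⟩ := ENNReal.lt_iff_exists_nnreal_btwn.1 ha
  refine (dimH_le_of_forall_cost hb hL0 hL hΨ ?_ fun ε (hε : ε ∈ T m) => hε).trans_lt hsa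
  rw [← div_lt_iff₀ hL0]
  exact lt_of_not_ge fun hle => hs.not_ge (by simpa using ENNReal.ofReal_le_ofReal hle)

end Cost

/-! ### Lower bounds for the dimension from the masses of cylinders -/

lemma le_hausdorffMeasure_of_scales {X : Type*} [EMetricSpace X] [MeasurableSpace X] [BorelSpace X]
    {ν : Measure X} {δ w : ℕ → ENNReal} {s : ℝ} (hs : 0 ≤ s) (hδ : ∀ n, δ n ≠ 0)
    (hw : Tendsto w atTop (𝓝 0)) (hν : ∀ᶠ n in atTop, ∀ U, Metric.ediam U < δ n → ν U ≤ w n)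
    (hscale : ∀ᶠ n in atTop, w n ≤ δ (n + 1) ^ s) : ν ≤ Measure.hausdorffMeasure s := by
  obtain ⟨m, hm⟩ := eventually_atTop.1 (hν.and hscale)
  obtain ⟨r, hr0, hr⟩ := exists_between (pos_iff_ne_zero.2 (hδ m))
  refine Measure.le_hausdorffMeasure s ν r hr0 fun U hUr => ?_
  by_contra! hlarge
  have hsmall : ∀ n ≥ m, Metric.ediam U < δ n := fun n hn => by
    induction n, hn using Nat.le_induction with
    | base => exact hUr.trans_lt hr
    | succ n hn ih =>
      by_contra! hle
      exact hlarge.not_ge (((hm n hn).1 U ih).trans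
        ((hm n hn).2.trans (ENNReal.rpow_le_rpow hle hs)))
  refine hlarge.not_ge ((ge_of_tendsto hw ?_).trans (zero_le))
  filter_upwards [eventually_ge_atTop m] with n hn using (hm n hn).1 U (hsmall n hn)

/-- The sum of the Cantor series with digits `ε`, as a function of all digit sequences (`0` when
the series diverges). Mass distributions on the digit space are transported to `ℝ` along it. -/
def expansionValue (b ε : ℕ → ℕ) : ℝ := ∑' i, (ε i : ℝ) / ∏ k ∈ range (i + 1), (b k : ℝ)

lemma measurable_expansionValue (b : ℕ → ℕ) : Measurable (expansionValue b) :=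
  Measurable.tsum fun i =>
    (measurable_of_countable fun m : ℕ => (m : ℝ) / ∏ k ∈ range (i + 1), (b k : ℝ)).comp
      (measurable_pi_apply i)

section MassDistribution

variable {b ε ε' : ℕ → ℕ} {x y : ℝ} {n : ℕ} {P : Measure (ℕ → ℕ)} {G : Set (ℕ → ℕ)}

lemma IsExpansion.expansionValue_eq (hx : IsExpansion b ε x) : expansionValue b ε = x :=
  hx.2.tsum_eq

lemma IsExpansion.radixValue_le_add_one (hx : IsExpansion b ε x) (hy : IsExpansion b ε' y)
    (h : |x - y| < (baseProd b n)⁻¹) : radixValue b ε n ≤ radixValue b ε' n + 1 := by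
  have hxl := hx.radixValue_div_le n
  have hyu := hy.le_radixValue_add_one_div n
  have hlt : (radixValue b ε n : ℝ) / baseProd b n < (radixValue b ε' n + 2) / baseProd b n := by
    rw [add_div, div_eq_mul_inv 2]
    rw [add_div, one_div] at hyu
    linarith [(abs_sub_lt_iff.1 h).1]
  rw [div_lt_div_iff_of_pos_right (baseProd_pos hx.base_pos n)] at hlt
  exact Nat.le_of_lt_succ (by exact_mod_cast hlt)

lemma measure_radixValue_eq_le (hG : ∀ ε ∈ G, ∀ i, ε i < b i) {w : ENNReal}
    (hw : ∀ ε ∈ G, P (PiNat.cylinder ε n) ≤ w) (M : ℕ) :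
    P {ε ∈ G | radixValue b ε n = M} ≤ w := by
  rcases Set.eq_empty_or_nonempty {ε ∈ G | radixValue b ε n = M} with h | ⟨ε₁, h₁, hM⟩
  · simp [h]
  · exact (measure_mono fun ε hε =>
      eq_of_radixValue_eq (hG ε hε.1) (hG ε₁ h₁) (hε.2.trans hM.symm)).trans (hw ε₁ h₁)

/-- A set of diameter less than `(b_1 ⋯ b_n)⁻¹` meets at most three neighbouring basic intervals of
order `n`. -/
lemma measure_preimage_expansionValue_inter_le
    (hG : ∀ ε ∈ G, IsExpansion b ε (expansionValue b ε)) {w : ENNReal}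
    (hw : ∀ ε ∈ G, P (PiNat.cylinder ε n) ≤ w) {U : Set ℝ}
    (hU : Metric.ediam U < ENNReal.ofReal (baseProd b n)⁻¹) :
    P (expansionValue b ⁻¹' U ∩ G) ≤ 3 * w := by
  rcases Set.eq_empty_or_nonempty (expansionValue b ⁻¹' U ∩ G) with h | ⟨ε₀, hU₀, hG₀⟩
  · simp [h]
  set M := radixValue b ε₀ n
  have hcov : expansionValue b ⁻¹' U ∩ G ⊆
      ⋃ m ∈ Icc (M - 1) (M + 1), {ε ∈ G | radixValue b ε n = m} := by
    rintro ε ⟨hεU, hε⟩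
    have hdist := (Metric.edist_le_ediam_of_mem (Set.mem_preimage.1 hεU) hU₀).trans_lt hU
    rw [edist_dist, ENNReal.ofReal_lt_ofReal_iff
      (inv_pos.2 (baseProd_pos (hG ε hε).base_pos n)), Real.dist_eq] at hdist
    have hle := (hG ε hε).radixValue_le_add_one (hG ε₀ hG₀) hdist
    have hge := (hG ε₀ hG₀).radixValue_le_add_one (hG ε hε) (by rwa [abs_sub_comm])
    exact Set.mem_biUnion (mem_coe.2 (mem_Icc.2 ⟨by omega, hle⟩)) ⟨hε, rfl⟩
  calc P (expansionValue b ⁻¹' U ∩ G)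
      ≤ ∑ m ∈ Icc (M - 1) (M + 1), P {ε ∈ G | radixValue b ε n = m} :=
        (measure_mono hcov).trans (measure_biUnion_finset_le _ _)
    _ ≤ (Icc (M - 1) (M + 1)).card • w :=
        sum_le_card_nsmul _ _ _ fun m _ => measure_radixValue_eq_le (fun ε hε => (hG ε hε).1) hw m
    _ ≤ 3 * w := by
        rw [nsmul_eq_mul, Nat.card_Icc]
        gcongr
        norm_cast
        omega

lemma eventually_exp_le_rpow_inv_baseProd (hb : ∀ i, 0 < b i) {L : ℝ}
    (hL : Tendsto (fun n : ℕ => (∑ i ∈ range n, Real.log (b i)) / n) atTop (𝓝 L)) {s c : ℝ}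
    (hs : s * L < c) (C : ℝ) :
    ∀ᶠ n : ℕ in atTop, Real.exp (C - n * c) ≤ (baseProd b (n + 1))⁻¹ ^ s := by
  obtain ⟨a, hsa, hac⟩ := exists_between hs
  filter_upwards [(tendsto_add_atTop_iff_nat 1).2 (hL.const_mul s) |>.eventually_lt_const hsa,
    (tendsto_natCast_atTop_atTop.atTop_mul_const (sub_pos.2 hac)).eventually_ge_atTop (a + C)]
    with n hn hnC
  rw [← log_baseProd hb, ← mul_div_assoc, div_lt_iff₀ (by positivity)] at hn
  rw [Real.rpow_def_of_pos (inv_pos.2 (baseProd_pos hb _)), Real.log_inv, Real.exp_le_exp]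
  push_cast at hn
  linarith

lemma le_dimH_of_forall_measure_cylinder (hb : ∀ i, 0 < b i) {L : ℝ}
    (hL : Tendsto (fun n : ℕ => (∑ i ∈ range n, Real.log (b i)) / n) atTop (𝓝 L))
    (hPG : P G ≠ 0) {T : Set ℝ} (hT : ∀ ε ∈ G, ∃ x ∈ T, IsExpansion b ε x) {c : ℝ} {m : ℕ}
    (hc : ∀ ε ∈ G, ∀ n ≥ m, P (PiNat.cylinder ε n) ≤ ENNReal.ofReal (Real.exp (-(n * c))))
    {s : NNReal} (hs : s * L < c) : (s : ENNReal) ≤ dimH T := by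
  have hG : ∀ ε ∈ G, expansionValue b ε ∈ T ∧ IsExpansion b ε (expansionValue b ε) := fun ε hε => by
    obtain ⟨x, hxT, hx⟩ := hT ε hε
    exact hx.expansionValue_eq.symm ▸ ⟨hxT, hx⟩
  have hV := measurable_expansionValue b
  suffices hν : (P.restrict G).map (expansionValue b) ≤ Measure.hausdorffMeasure s by
    refine le_dimH_of_hausdorffMeasure_ne_zero fun h0 => hPG (le_zero_iff.1 ?_)
    rw [← h0, ← Measure.restrict_apply_self P G]
    exact (measure_mono fun ε hε => (hG ε hε).1).trans
      ((Measure.le_map_apply hV.aemeasurable T).trans (hν T))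
  refine le_hausdorffMeasure_of_scales (δ := fun n => ENNReal.ofReal (baseProd b n)⁻¹)
    (w := fun n => 3 * ENNReal.ofReal (Real.exp (-(n * c)))) s.2
    (fun n => by simpa using baseProd_pos hb n) ?_ ?_ ?_
  · have hL0 : 0 ≤ L := ge_of_tendsto' hL fun n =>
      div_nonneg (sum_nonneg fun i _ => Real.log_natCast_nonneg _) n.cast_nonneg
    have hexp : Tendsto (fun n : ℕ => Real.exp (-(n * c))) atTop (𝓝 0) :=
      Real.tendsto_exp_neg_atTop_nhds_zero.comp
        (tendsto_natCast_atTop_atTop.atTop_mul_const ((mul_nonneg s.2 hL0).trans_lt hs))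
    simpa using ENNReal.Tendsto.const_mul (ENNReal.tendsto_ofReal hexp) (.inr ENNReal.ofNat_ne_top)
  · filter_upwards [eventually_ge_atTop m] with n hn U hU
    refine (measure_mono subset_closure).trans ?_
    rw [Measure.map_apply hV measurableSet_closure,
      Measure.restrict_apply (hV measurableSet_closure)]
    exact measure_preimage_expansionValue_inter_le (fun ε hε => (hG ε hε).2)
      (fun ε hε => hc ε hε n hn) (by rwa [Metric.ediam_closure])
  · filter_upwards [eventually_exp_le_rpow_inv_baseProd hb hL hs (Real.log 3)] with n hn
    rw [ENNReal.ofReal_rpow_of_pos (inv_pos.2 (baseProd_pos hb _)),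
      ← ENNReal.ofReal_ofNat 3, ← ENNReal.ofReal_mul (by norm_num)]
    refine ENNReal.ofReal_le_ofReal (le_of_eq_of_le ?_ hn)
    rw [sub_eq_add_neg, Real.exp_add, Real.exp_log three_pos]

theorem le_dimH_of_measure_cylinder (hb : ∀ i, 0 < b i) {L : ℝ}
    (hL : Tendsto (fun n : ℕ => (∑ i ∈ range n, Real.log (b i)) / n) atTop (𝓝 L)) [NeZero P]
    {T : Set ℝ} (hT : ∀ᵐ ε ∂P, ∃ x ∈ T, IsExpansion b ε x) {c : ℝ}
    (hc : ∀ᵐ ε ∂P, ∀ᶠ n : ℕ in atTop,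
      P (PiNat.cylinder ε n) ≤ ENNReal.ofReal (Real.exp (-(n * c))))
    {s : NNReal} (hs : s * L < c) : (s : ENNReal) ≤ dimH T := by
  let G (m : ℕ) : Set (ℕ → ℕ) := {ε | (∃ x ∈ T, IsExpansion b ε x) ∧
    ∀ n ≥ m, P (PiNat.cylinder ε n) ≤ ENNReal.ofReal (Real.exp (-(n * c)))}
  obtain ⟨m, hm⟩ : ∃ m, 0 < P (G m) := by
    refine exists_measure_pos_of_not_measure_iUnion_null
      (frequently_ae_mem_iff.1 (Eventually.frequently ?_))
    filter_upwards [hT, hc] with ε hεT hεc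
    exact Set.mem_iUnion.2 ((eventually_atTop.1 hεc).imp fun m hm => ⟨hεT, hm⟩)
  exact le_dimH_of_forall_measure_cylinder hb hL hm.ne' (fun ε hε => hε.1) (fun ε hε => hε.2) hs

end MassDistribution

/-! ### Strong law of large numbers -/

section StrongLaw

variable {Ω : Type*} [MeasurableSpace Ω] {P : Measure Ω} {X : ℕ → Ω → ℝ}

lemma ae_eventually_sum_lt_of_hasSubgaussianMGF (hind : iIndepFun X P) {c : NNReal} (hc : c ≠ 0)
    (hX : ∀ i, HasSubgaussianMGF (X i) c P) {e : ℝ} (he : 0 < e) :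
    ∀ᵐ ω ∂P, ∀ᶠ n : ℕ in atTop, ∑ i ∈ range n, X i ω < n * e := by
  have := hind.isProbabilityMeasure
  have hprob : ∀ n : ℕ, P {ω | n * e ≤ ∑ i ∈ range n, X i ω} ≤
      ENNReal.ofReal (Real.exp (-(e ^ 2 / (2 * c))) ^ n) := by
    intro n
    rw [← ofReal_measureReal]
    refine ENNReal.ofReal_le_ofReal ((HasSubgaussianMGF.measure_sum_range_ge_le_of_iIndepFun hind
      (fun i _ => hX i) (by positivity)).trans_eq ?_)
    rw [← Real.exp_nat_mul]
    rcases eq_or_ne n 0 with rfl | _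
    · simp
    · field_simp
  have hexp : Real.exp (-(e ^ 2 / (2 * c))) < 1 :=
    Real.exp_lt_one_iff.2 (neg_lt_zero.2 (by positivity))
  filter_upwards [ae_eventually_notMem (ne_top_of_le_ne_top
    (summable_geometric_of_lt_one (Real.exp_pos _).le hexp).tsum_ofReal_ne_top
    (ENNReal.tsum_le_tsum hprob))] with ω hω
  simpa using hω

lemma ae_tendsto_average_zero_of_hasSubgaussianMGF (hind : iIndepFun X P) {c : NNReal}
    (hc : c ≠ 0) (hX : ∀ i, HasSubgaussianMGF (X i) c P) :
    ∀ᵐ ω ∂P, Tendsto (fun n : ℕ => (∑ i ∈ range n, X i ω) / n) atTop (𝓝 0) := by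
  have hupper : ∀ᵐ ω ∂P, ∀ m : ℕ, ∀ᶠ n : ℕ in atTop,
      ∑ i ∈ range n, X i ω < n * (1 / ((m : ℝ) + 1)) := ae_all_iff.2 fun m =>
    ae_eventually_sum_lt_of_hasSubgaussianMGF hind hc hX (by positivity)
  have hlower : ∀ᵐ ω ∂P, ∀ m : ℕ, ∀ᶠ n : ℕ in atTop,
      ∑ i ∈ range n, -X i ω < n * (1 / ((m : ℝ) + 1)) := ae_all_iff.2 fun m =>
    ae_eventually_sum_lt_of_hasSubgaussianMGF (hind.comp (fun _ x => -x) fun _ => measurable_neg)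
      hc (fun i => (hX i).neg) (by positivity)
  filter_upwards [hupper, hlower] with ω hωu hωl
  refine Metric.tendsto_nhds.2 fun e he => ?_
  obtain ⟨m, hm⟩ := exists_nat_one_div_lt he
  filter_upwards [hωu m, hωl m, eventually_gt_atTop 0] with n hu hl hn
  have hn' : (0 : ℝ) < n := Nat.cast_pos.2 hn
  rw [sum_neg_distrib] at hl
  rw [Real.dist_eq, sub_zero, abs_div, abs_of_pos hn', div_lt_iff₀ hn', abs_lt]
  constructor <;> nlinarith

lemma ae_tendsto_average_sub_integral (hind : iIndepFun X P)
    (hm : ∀ i, AEMeasurable (X i) P) {a b : ℝ} (hab : a < b)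
    (hX : ∀ i, ∀ᵐ ω ∂P, X i ω ∈ Set.Icc a b) :
    ∀ᵐ ω ∂P, Tendsto (fun n : ℕ => (∑ i ∈ range n, (X i ω - ∫ ω, X i ω ∂P)) / n) atTop (𝓝 0) :=
  have := hind.isProbabilityMeasure
  ae_tendsto_average_zero_of_hasSubgaussianMGF
    (hind.comp (fun i x => x - ∫ ω, X i ω ∂P) fun _ => measurable_id.sub_const _)
    (by simpa using (sub_pos.2 hab).ne') fun i => hasSubgaussianMGF_of_mem_Icc (hm i) (hX i)

end StrongLaw

lemma ae_hasFrequencies_pair [Countable κ] [DecidableEq κ] [Countable S] [DecidableEq S]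
    [MeasurableSpace S] [MeasurableSingletonClass S] {u : ℕ → κ} {d : κ → ℝ}
    (hu : HasFrequencies u d) (μ : κ → Measure S) [∀ i, IsProbabilityMeasure (μ (u i))] :
    ∀ᵐ ε ∂(Measure.infinitePi fun i => μ (u i)),
      HasFrequencies (fun i => (u i, ε i)) fun v => d v.1 * (μ v.1).real {v.2} := by
  refine ae_all_iff.2 fun ⟨k, s⟩ => ?_
  let A (i : ℕ) : Set S := if u i = k then {s} else ∅
  have hA (i : ℕ) : MeasurableSet (A i) := .of_discrete
  let X (i : ℕ) (x : S) : ℝ := (A i).indicator 1 x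
  have hX (i : ℕ) : Measurable (X i) := measurable_one.indicator (hA i)
  have hmean_digit (i : ℕ) : ∫ ε, X i (ε i) ∂(Measure.infinitePi fun i => μ (u i)) =
      if u i = k then (μ k).real {s} else 0 := by
    rw [← integral_map (φ := fun ε : ℕ → S => ε i) (f := X i)
      (measurable_pi_apply i).aemeasurable (hX i).aestronglyMeasurable,
      Measure.infinitePi_map_eval, integral_indicator_one (hA i)]
    by_cases h : u i = k <;> simp [A, h]
  filter_upwards [ae_tendsto_average_sub_integral (iIndepFun_infinitePi hX)
    (fun i => ((hX i).comp (measurable_pi_apply i)).aemeasurable) zero_lt_one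
    fun i => .of_forall fun ε => by by_cases h : ε i ∈ A i <;> simp [X, h]] with ε hε
  refine (zero_add (d k * (μ k).real {s}) ▸ hε.add ((hu k).mul_const _)).congr fun n => ?_
  simp only [hmean_digit, sum_sub_distrib, ← sum_filter, sum_const, nsmul_eq_mul]
  rw [div_mul_eq_mul_div, ← add_div, sub_add_cancel, ← sum_boole]
  congr 1
  refine sum_congr rfl fun i _ => ?_
  by_cases h : u i = k <;> simp [X, A, h, Set.indicator_apply]

/-! ### Independent digits with prescribed rows -/

/-- The measure on `ℕ` that gives the point `j` the mass `q j`. -/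
def weightMeasure (q : ℕ → ℝ) : Measure ℕ :=
  Measure.count.withDensity fun j => ENNReal.ofReal (q j)

/-- The law of a sequence of independent digits, the `i`-th of which is distributed according to the
row `b i` of the array `p`. -/
def digitLaw (b : ℕ → ℕ) (p : ℕ → ℕ → ℝ) : Measure (ℕ → ℕ) :=
  Measure.infinitePi fun i => weightMeasure (p (b i))

/-- The Shannon entropy of the `n`-th row of an array. -/
def rowEntropy (p : ℕ → ℕ → ℝ) (n : ℕ) : ℝ := ∑ j ∈ range n, Real.negMulLog (p n j)

lemma weightMeasure_singleton (q : ℕ → ℝ) (j : ℕ) :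
    weightMeasure q {j} = ENNReal.ofReal (q j) := by
  rw [weightMeasure, withDensity_apply _ (measurableSet_singleton j), lintegral_singleton,
    Measure.count_singleton, mul_one]

lemma IsStochastic.le_one {q : ℕ → ℝ} (hq : IsStochastic q) (j : ℕ) : q j ≤ 1 :=
  le_hasSum hq.2 j fun i _ => hq.1 i

lemma IsStochastic.isProbabilityMeasure {q : ℕ → ℝ} (hq : IsStochastic q) :
    IsProbabilityMeasure (weightMeasure q) := by
  refine ⟨?_⟩
  rw [weightMeasure, withDensity_apply _ .univ, Measure.restrict_univ, lintegral_count,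
    ← ENNReal.ofReal_tsum_of_nonneg hq.1 hq.2.summable, hq.2.tsum_eq, ENNReal.ofReal_one]

lemma isStochastic_of_mem_tables {p : ℕ → ℕ → ℝ} (hp : p ∈ tables) {n : ℕ} (hn : 2 ≤ n) :
    IsStochastic (p n) := by
  obtain ⟨hnonneg, hzero, hsum⟩ := hp n hn
  exact ⟨hnonneg, hsum ▸ hasSum_sum_of_ne_finset_zero fun j hj => hzero j (by simpa using hj)⟩

section Tables

variable {d : ℕ → ℝ} {p : ℕ → ℕ → ℝ}

lemma mul_nonneg_of_mem_tables (hd : ∀ n, 0 ≤ d n) (hbase : ∀ n, d n ≠ 0 → 2 ≤ n)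
    (hp : p ∈ tables) (n j : ℕ) : 0 ≤ d n * p n j := by
  rcases eq_or_ne (d n) 0 with h | h
  · simp [h]
  · exact mul_nonneg (hd n) ((hp n (hbase n h)).1 j)

lemma hasSum_mul_of_mem_tables (hbase : ∀ n, d n ≠ 0 → 2 ≤ n) (hp : p ∈ tables) (n : ℕ) :
    HasSum (fun j => d n * p n j) (d n) := by
  rcases eq_or_ne (d n) 0 with h | h
  · simp [h]
  · simpa using (isStochastic_of_mem_tables hp (hbase n h)).2.mul_left (d n)

lemma hasSum_mul_prod_of_mem_tables (hd : IsStochastic d) (hbase : ∀ n, d n ≠ 0 → 2 ≤ n)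
    (hp : p ∈ tables) : HasSum (fun v : ℕ × ℕ => d v.1 * p v.1 v.2) 1 := by
  have hrow := hasSum_mul_of_mem_tables hbase hp
  have hsum : Summable fun v : ℕ × ℕ => d v.1 * p v.1 v.2 :=
    (summable_prod_of_nonneg fun v => mul_nonneg_of_mem_tables hd.1 hbase hp v.1 v.2).2
      ⟨fun n => (hrow n).summable, by simpa only [(hrow _).tsum_eq] using hd.2.summable⟩
  exact (hsum.hasSum.prod_fiberwise hrow).unique hd.2 ▸ hsum.hasSum

end Tables

section LowerBound

variable {b : ℕ → ℕ} {d α : ℕ → ℝ} {p : ℕ → ℕ → ℝ}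

lemma base_ge_two_of_hasFrequencies (hb : ∀ i, 2 ≤ b i) (hd : HasFrequencies b d) {n : ℕ}
    (hn : d n ≠ 0) : 2 ≤ n := by
  by_contra! hn2
  exact hn (hd.eq_zero_of_forall_ne fun i => (hn2.trans_le (hb i)).ne')

lemma digitLaw_cylinder (hp : ∀ i, IsStochastic (p (b i))) (ε : ℕ → ℕ) (n : ℕ) :
    digitLaw b p (PiNat.cylinder ε n) = ENNReal.ofReal (∏ i ∈ range n, p (b i) (ε i)) := by
  have := fun i => (hp i).isProbabilityMeasure
  rw [PiNat.cylinder_eq_pi, digitLaw,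
    Measure.infinitePi_pi _ fun i _ => measurableSet_singleton _,
    ENNReal.ofReal_prod_of_nonneg fun i _ => (hp i).1 _]
  exact prod_congr rfl fun i _ => weightMeasure_singleton _ _

lemma ae_digitLaw_forall_pos (hp : ∀ i, IsStochastic (p (b i))) :
    ∀ᵐ ε ∂digitLaw b p, ∀ i, 0 < p (b i) (ε i) := by
  have := fun i => (hp i).isProbabilityMeasure
  refine ae_all_iff.2 fun i => ?_
  have hrow : ∀ᵐ j ∂(digitLaw b p).map (fun ε => ε i), 0 < p (b i) j := by
    rw [digitLaw, Measure.infinitePi_map_eval, ae_iff_of_countable]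
    intro j hj
    rwa [weightMeasure_singleton, ENNReal.ofReal_ne_zero_iff] at hj
  exact ae_of_ae_map (measurable_pi_apply i).aemeasurable hrow

lemma ae_digitLaw_hasFrequencies (hd : HasFrequencies b d) (hp : ∀ i, IsStochastic (p (b i))) :
    ∀ᵐ ε ∂digitLaw b p, HasFrequencies (fun i => (b i, ε i)) fun v => d v.1 * p v.1 v.2 := by
  have := fun i => (hp i).isProbabilityMeasure
  filter_upwards [ae_hasFrequencies_pair hd fun k => weightMeasure (p k)] with ε hε v
  have hv : d v.1 * (weightMeasure (p v.1)).real {v.2} = d v.1 * p v.1 v.2 := by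
    by_cases hv : ∃ i, b i = v.1
    · obtain ⟨i, hi⟩ := hv
      rw [measureReal_def, weightMeasure_singleton, ENNReal.toReal_ofReal (hi ▸ (hp i).1 _)]
    · simp [hd.eq_zero_of_forall_ne (not_exists.1 hv)]
  simpa only [hv] using hε v

lemma ae_eventually_digitLaw_cylinder_le (hd : HasFrequencies b d)
    (hp : ∀ i, IsStochastic (p (b i))) {c : ℝ} {K : Finset (ℕ × ℕ)}
    (hc : c < ∑ v ∈ K, d v.1 * Real.negMulLog (p v.1 v.2)) :
    ∀ᵐ ε ∂digitLaw b p, ∀ᶠ n : ℕ in atTop,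
      digitLaw b p (PiNat.cylinder ε n) ≤ ENNReal.ofReal (Real.exp (-(n * c))) := by
  filter_upwards [ae_digitLaw_hasFrequencies hd hp, ae_digitLaw_forall_pos hp] with ε hfreq hpos
  have hlim := hfreq.tendsto_average K fun v => -Real.log (p v.1 v.2)
  simp only [mul_assoc, ← neg_mul_comm, ← neg_mul_eq_neg_mul] at hlim hc
  filter_upwards [hlim.eventually_const_lt (by simpa [Real.negMulLog] using hc),
    eventually_gt_atTop 0] with n hn hn0
  rw [lt_div_iff₀ (Nat.cast_pos.2 hn0)] at hn
  rw [digitLaw_cylinder hp, ← Real.exp_log (prod_pos fun i (_ : i ∈ range n) => hpos i),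
    Real.log_prod fun i _ => (hpos i).ne']
  refine ENNReal.ofReal_le_ofReal (Real.exp_le_exp.2 ?_)
  have hle : (∑ i ∈ range n, if (b i, ε i) ∈ K then -Real.log (p (b i) (ε i)) else 0) ≤
      ∑ i ∈ range n, -Real.log (p (b i) (ε i)) := sum_le_sum fun i _ => by
    have := Real.log_nonpos (hpos i).le ((hp i).le_one _)
    split_ifs <;> linarith
  rw [sum_neg_distrib] at hle
  linarith

lemma sum_product_negMulLog (hp : ∀ k, d k ≠ 0 → ∀ j, k ≤ j → p k j = 0) (N : ℕ) :
    ∑ v ∈ range N ×ˢ range N, d v.1 * Real.negMulLog (p v.1 v.2) =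
      ∑ k ∈ range N, d k * rowEntropy p k := by
  rw [sum_product]
  refine sum_congr rfl fun k hk => ?_
  rw [rowEntropy, mul_sum]
  refine (sum_subset (range_subset_range.2 (mem_range.1 hk).le) fun j _ hj => ?_).symm
  rcases eq_or_ne (d k) 0 with h | h
  · simp [h]
  · simp [hp k h j (by simpa using hj)]

lemma ae_digitLaw_exists_mem_levelSet (hb : ∀ i, 2 ≤ b i) (hd : HasFrequencies b d)
    (hd1 : HasSum d 1) (hp : p ∈ tablesWith d α) :
    ∀ᵐ ε ∂digitLaw b p, ∃ x ∈ levelSet b α, IsExpansion b ε x := by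
  have hrow : ∀ i, IsStochastic (p (b i)) := fun i => isStochastic_of_mem_tables hp.1 (hb i)
  filter_upwards [ae_digitLaw_hasFrequencies hd hrow, ae_digitLaw_forall_pos hrow]
    with ε hfreq hpos
  have hx : IsExpansion b ε (expansionValue b ε) := by
    have hε : ∀ i, ε i < b i := fun i =>
      lt_of_not_ge fun hle => (hpos i).ne' ((hp.1 _ (hb i)).2.1 _ hle)
    exact ⟨hε, (summable_expansion hε).hasSum⟩
  have hprod := hasSum_mul_prod_of_mem_tables ⟨hd.nonneg, hd1⟩
    (fun n => base_ge_two_of_hasFrequencies hb hd) hp.1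
  refine ⟨_, ⟨hx.mem_Icc, ε, hx, hfreq.map (φ := Prod.snd) hprod fun j => ?_⟩, hx⟩
  refine (Function.Injective.hasSum_iff (Prod.mk_left_injective j) fun v hv => ?_).1 ?_
  · exact if_neg fun hj => hv ⟨v.1, Prod.ext rfl hj.symm⟩
  · simpa [Function.comp_def] using hp.2 j

theorem le_dimH_levelSet (hb : ∀ i, 2 ≤ b i) (hd : HasFrequencies b d) (hd1 : HasSum d 1)
    {L : ℝ} (hL0 : 0 < L)
    (hL : Tendsto (fun n : ℕ => (∑ i ∈ range n, Real.log (b i)) / n) atTop (𝓝 L))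
    (hp : p ∈ tablesWith d α) {h : ℝ} (hh : HasSum (fun n => d n * rowEntropy p n) h) :
    ENNReal.ofReal (h / L) ≤ dimH (levelSet b α) := by
  have hrow : ∀ i, IsStochastic (p (b i)) := fun i => isStochastic_of_mem_tables hp.1 (hb i)
  have := fun i => (hrow i).isProbabilityMeasure
  have : NeZero (digitLaw b p) := inferInstanceAs (NeZero (Measure.infinitePi _))
  refine le_of_forall_lt fun a ha => ?_
  obtain ⟨s, has, hs⟩ := ENNReal.lt_iff_exists_nnreal_btwn.1 ha
  refine has.trans_le ?_
  have hsL : s * L < h := by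
    rw [← lt_div_iff₀ hL0]
    exact lt_of_not_ge fun hle => hs.not_ge (by simpa using ENNReal.ofReal_le_ofReal hle)
  obtain ⟨N, hN⟩ := (hh.tendsto_sum_nat.eventually_const_lt hsL).exists
  rw [← sum_product_negMulLog fun k hk =>
    (hp.1 k (base_ge_two_of_hasFrequencies hb hd hk)).2.1] at hN
  obtain ⟨c, hsc, hc⟩ := exists_between hN
  exact le_dimH_of_measure_cylinder (fun i => two_pos.trans_le (hb i)) hL
    (ae_digitLaw_exists_mem_levelSet hb hd hd1 hp)
    (ae_eventually_digitLaw_cylinder_le hd hrow hc) hsc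

end LowerBound

/-! ### The product weights -/

/-- The relation between the frequencies `d` of the bases and `α` of the digits that the product
weights `t j * r n` rely on: the digits used in the bases up to `n` are smaller than `n`, so these
bases together are at most as frequent as the digits below `n`. -/
structure IsFeasible (d α : ℕ → ℝ) : Prop where
  base : IsStochastic d
  digit : IsStochastic α
  sum_base_le : ∀ n, ∑ k ∈ range (n + 1), d k ≤ ∑ j ∈ range n, α j

/-- The product `∏_{k=j₀+1}^{n-1} (1 - d_k / A_k)` that occurs in `seqT` and `seqR`. -/
def seqP (d α : ℕ → ℝ) (n : ℕ) : ℝ :=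
  ∏ k ∈ Ico (firstIndex α + 1) n, (1 - d k / seqA d α k)

section Weights

variable {d α : ℕ → ℝ} {p : ℕ → ℕ → ℝ}

lemma isFeasible_of_mem_tablesWith (hd : IsStochastic d) (hbase : ∀ n, d n ≠ 0 → 2 ≤ n)
    (hα : IsStochastic α) (hp : p ∈ tablesWith d α) : IsFeasible d α := by
  refine ⟨hd, hα, fun n => ?_⟩
  have hrow : ∀ k ∈ range (n + 1), d k = ∑ j ∈ range n, d k * p k j := fun k hk => by
    refine (hasSum_mul_of_mem_tables hbase hp.1 k).unique
      (hasSum_sum_of_ne_finset_zero fun j hj => ?_)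
    rcases eq_or_ne (d k) 0 with h | h
    · simp [h]
    · rw [mem_range] at hk hj
      rw [(hp.1 k (hbase k h)).2.1 j (by omega), mul_zero]
  rw [sum_congr rfl hrow, sum_comm]
  exact sum_le_sum fun j _ =>
    sum_le_hasSum _ (fun k _ => mul_nonneg_of_mem_tables hd.1 hbase hp.1 k j) (hp.2 j)

lemma eq_zero_of_lt_firstIndex {j : ℕ} (hj : j < firstIndex α) : α j = 0 :=
  of_not_not fun h => hj.not_ge (Nat.sInf_le h)

lemma sum_range_firstIndex : ∑ j ∈ range (firstIndex α), α j = 0 :=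
  sum_eq_zero fun _ hj => eq_zero_of_lt_firstIndex (mem_range.1 hj)

lemma seqP_firstIndex_add_one : seqP d α (firstIndex α + 1) = 1 := by simp [seqP]

lemma seqP_succ {n : ℕ} (hn : firstIndex α + 1 ≤ n) :
    seqP d α (n + 1) = seqP d α n * (1 - d n / seqA d α n) :=
  prod_Ico_succ_top hn _

lemma seqT_eq_div (j : ℕ) : seqT d α j = α j / seqP d α (j + 1) := by
  rw [seqT, seqP, Ico_add_one_right_eq_Icc]

lemma seqR_eq_div (n : ℕ) : seqR d α n = seqP d α n / seqA d α n := by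
  rw [seqR, seqP, one_div_mul_eq_div]

lemma base_mul_seqR {n : ℕ} (hn : firstIndex α + 1 ≤ n) :
    d n * seqR d α n = seqP d α n - seqP d α (n + 1) := by
  rw [seqP_succ hn, seqR_eq_div]
  ring

lemma seqP_mul_seqT (hne : ∀ j, α j ≠ 0 → seqP d α (j + 1) ≠ 0) (j : ℕ) :
    seqP d α (j + 1) * seqT d α j = α j := by
  rw [seqT_eq_div]
  exact mul_div_cancel_of_imp' fun h => of_not_not fun hj => hne j hj h

lemma seqT_ne_zero (hne : ∀ j, α j ≠ 0 → seqP d α (j + 1) ≠ 0) {j : ℕ} (hj : α j ≠ 0) :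
    seqT d α j ≠ 0 :=
  right_ne_zero_of_mul (seqP_mul_seqT hne j ▸ hj)

lemma seqP_add_one_ne_zero {j : ℕ}
    (hfactor : ∀ k ∈ Icc (firstIndex α + 1) j, 1 - d k / seqA d α k ≠ 0) :
    seqP d α (j + 1) ≠ 0 := by
  rw [seqP, Ico_add_one_right_eq_Icc]
  exact prod_ne_zero_iff.2 hfactor

namespace IsFeasible

variable (h : IsFeasible d α)
include h

lemma sum_base_range_firstIndex : ∑ k ∈ range (firstIndex α + 1), d k = 0 :=
  le_antisymm ((h.sum_base_le _).trans_eq sum_range_firstIndex) (sum_nonneg fun k _ => h.base.1 k)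

lemma base_eq_zero {k : ℕ} (hk : k ≤ firstIndex α) : d k = 0 :=
  (sum_eq_zero_iff_of_nonneg fun k _ => h.base.1 k).1 h.sum_base_range_firstIndex k
    (mem_range_succ_iff.2 hk)

lemma seqA_eq (n : ℕ) : seqA d α n = ∑ j ∈ range n, α j - ∑ k ∈ range n, d k := by
  rw [seqA]
  congr 1
  · refine sum_subset (by grind) fun j hj hj' => eq_zero_of_lt_firstIndex ?_
    simp only [mem_range, mem_Ico] at hj hj'
    omega
  · refine sum_subset (by grind) fun k hk hk' => h.base_eq_zero ?_
    simp only [mem_range, mem_Ico] at hk hk'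
    omega

lemma seqA_succ (n : ℕ) : seqA d α (n + 1) = seqA d α n + α n - d n := by
  rw [h.seqA_eq, h.seqA_eq, sum_range_succ, sum_range_succ]
  ring

lemma base_le_seqA (n : ℕ) : d n ≤ seqA d α n := by
  have := h.sum_base_le n
  rw [sum_range_succ] at this
  rw [h.seqA_eq]
  linarith

lemma seqA_nonneg (n : ℕ) : 0 ≤ seqA d α n := (h.base.1 n).trans (h.base_le_seqA n)

lemma seqA_le (n : ℕ) : seqA d α n ≤ 1 - ∑ k ∈ range n, d k := by
  rw [h.seqA_eq]
  exact sub_le_sub_right (sum_le_hasSum _ (fun j _ => h.digit.1 j) h.digit.2) _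

lemma div_seqA_mul_seqA (n : ℕ) : d n / seqA d α n * seqA d α n = d n :=
  div_mul_cancel_of_imp fun h0 => le_antisymm (h0 ▸ h.base_le_seqA n) (h.base.1 n)

lemma div_seqA_le_one (n : ℕ) : d n / seqA d α n ≤ 1 :=
  div_le_one_of_le₀ (h.base_le_seqA n) (h.seqA_nonneg n)

lemma seqP_nonneg (n : ℕ) : 0 ≤ seqP d α n :=
  prod_nonneg fun k _ => sub_nonneg.2 (h.div_seqA_le_one k)

lemma seqT_nonneg (j : ℕ) : 0 ≤ seqT d α j := by
  rw [seqT_eq_div]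
  exact div_nonneg (h.digit.1 j) (h.seqP_nonneg _)

lemma seqR_nonneg (n : ℕ) : 0 ≤ seqR d α n := by
  rw [seqR_eq_div]
  exact div_nonneg (h.seqP_nonneg n) (h.seqA_nonneg n)

lemma seqP_le {n : ℕ} (hn : firstIndex α + 1 ≤ n) : seqP d α n ≤ 1 - ∑ k ∈ range n, d k := by
  induction n, hn using Nat.le_induction with
  | base => rw [seqP_firstIndex_add_one, h.sum_base_range_firstIndex, sub_zero]
  | succ n hn ih =>
    calc
      seqP d α (n + 1) = seqP d α n * (1 - d n / seqA d α n) := seqP_succ hn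
      _ ≤ (1 - ∑ k ∈ range n, d k) * (1 - d n / seqA d α n) :=
        mul_le_mul_of_nonneg_right ih (sub_nonneg.2 (h.div_seqA_le_one n))
      _ = 1 - ∑ k ∈ range n, d k - d n / seqA d α n * (1 - ∑ k ∈ range n, d k) := by ring
      _ ≤ 1 - ∑ k ∈ range n, d k - d n / seqA d α n * seqA d α n :=
        sub_le_sub_left (mul_le_mul_of_nonneg_left (h.seqA_le n)
          (div_nonneg (h.base.1 n) (h.seqA_nonneg n))) _
      _ = 1 - ∑ k ∈ range (n + 1), d k := by
        rw [h.div_seqA_mul_seqA, sum_range_succ, sub_sub]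

lemma tendsto_seqP : Tendsto (seqP d α) atTop (𝓝 0) := by
  refine squeeze_zero' (.of_forall h.seqP_nonneg)
    ((eventually_ge_atTop (firstIndex α + 1)).mono fun n => h.seqP_le) ?_
  simpa using h.base.2.tendsto_sum_nat.const_sub 1

lemma hasSum_base_mul_seqR {j : ℕ} (hj : firstIndex α ≤ j) :
    HasSum (fun n => if j < n then d n * seqR d α n else 0) (seqP d α (j + 1)) := by
  have hpartial : ∀ m ≥ j + 1, ∑ n ∈ range m, (if j < n then d n * seqR d α n else 0) =
      seqP d α (j + 1) - seqP d α m := fun m hm => by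
    induction m, hm using Nat.le_induction with
    | base =>
      rw [sub_self]
      exact sum_eq_zero fun n hn => if_neg (not_lt.2 (mem_range_succ_iff.1 hn))
    | succ m hm ih =>
      rw [sum_range_succ, ih, if_pos (by omega), base_mul_seqR (by omega), sub_add_sub_cancel]
  rw [hasSum_iff_tendsto_nat_of_nonneg]
  · refine Tendsto.congr' ?_ (sub_zero (seqP d α (j + 1)) ▸ h.tendsto_seqP.const_sub _)
    filter_upwards [eventually_ge_atTop (j + 1)] with m hm using (hpartial m hm).symm
  · intro n
    split_ifs
    exacts [mul_nonneg (h.base.1 n) (h.seqR_nonneg n), le_rfl]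

section NonVanishing

variable (hne : ∀ j, α j ≠ 0 → seqP d α (j + 1) ≠ 0)
include hne

/-- Were the factor at `k < n` to vanish, then no digit `≥ k` could occur, and `d k = A k` would be
the total frequency of the bases `≥ k`. -/
lemma seqP_ne_zero_of_base_ne_zero {n : ℕ} (hn : d n ≠ 0) : seqP d α n ≠ 0 := by
  intro hP
  obtain ⟨k, hk, hk0⟩ := prod_eq_zero_iff.1 hP
  rw [mem_Ico] at hk
  have hdigit : ∀ j ∉ range k, α j = 0 := fun j hj => by
    refine of_not_not fun hαj => hne j hαj (prod_eq_zero (mem_Ico.2 ⟨hk.1, ?_⟩) hk0)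
    simpa [Nat.lt_succ_iff] using hj
  have hA := h.div_seqA_mul_seqA k
  rw [← sub_eq_zero.1 hk0, one_mul, h.seqA_eq,
    (hasSum_sum_of_ne_finset_zero hdigit).unique h.digit.2] at hA
  have hle := sum_le_hasSum (insert n (range (k + 1))) (fun j _ => h.base.1 j) h.base.2
  rw [sum_insert (by simpa using hk.2), sum_range_succ] at hle
  exact hn (le_antisymm (by linarith) (h.base.1 n))

lemma seqR_pos {n : ℕ} (hn : d n ≠ 0) : 0 < seqR d α n := by
  rw [seqR_eq_div]
  exact div_pos ((h.seqP_nonneg n).lt_of_ne' (h.seqP_ne_zero_of_base_ne_zero hne hn))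
    (((h.base.1 n).lt_of_ne' hn).trans_le (h.base_le_seqA n))

lemma seqP_mul_sum_seqT {n : ℕ} (hn : firstIndex α + 1 ≤ n) (hP : seqP d α n ≠ 0) :
    seqP d α n * ∑ j ∈ range n, seqT d α j = seqA d α n := by
  induction n, hn using Nat.le_induction with
  | base =>
    rw [sum_range_succ, sum_eq_zero, zero_add, seqP_mul_seqT hne, h.seqA_eq,
      h.sum_base_range_firstIndex, sum_range_succ, sum_range_firstIndex, zero_add, sub_zero]
    intro j hj
    rw [seqT_eq_div, eq_zero_of_lt_firstIndex (mem_range.1 hj), zero_div]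
  | succ n hn ih =>
    have hsum := ih (left_ne_zero_of_mul (seqP_succ (d := d) hn ▸ hP))
    rw [sum_range_succ, mul_add, seqP_mul_seqT hne, h.seqA_succ, seqP_succ hn]
    linear_combination (1 - d n / seqA d α n) * hsum - h.div_seqA_mul_seqA n

lemma sum_seqT_mul_seqR {n : ℕ} (hn : d n ≠ 0) :
    ∑ j ∈ range n, seqT d α j * seqR d α n = 1 := by
  have hlt : firstIndex α + 1 ≤ n := lt_of_not_ge fun hle => hn (h.base_eq_zero hle)
  have hA := ((h.base.1 n).lt_of_ne' hn).trans_le (h.base_le_seqA n)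
  rw [← sum_mul, seqR_eq_div, mul_div_assoc', mul_comm,
    h.seqP_mul_sum_seqT hne hlt (h.seqP_ne_zero_of_base_ne_zero hne hn), div_self hA.ne']

end NonVanishing

end IsFeasible

/-- The table with the entries `t j * r n`. Where the base `n` has frequency zero these need not
sum to one, and an arbitrary probability vector is taken as the `n`-th row. -/
def productTable (d α : ℕ → ℝ) (n : ℕ) : ℕ → ℝ :=
  if d n = 0 then Pi.single 0 1 else fun j => if j < n then seqT d α j * seqR d α n else 0

lemma productTable_apply {n j : ℕ} (hn : d n ≠ 0) (hj : j < n) :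
    productTable d α n j = seqT d α j * seqR d α n := by
  rw [productTable, if_neg hn, if_pos hj]

lemma IsFeasible.productTable_mem_tables (h : IsFeasible d α)
    (hne : ∀ j, α j ≠ 0 → seqP d α (j + 1) ≠ 0) : productTable d α ∈ tables := by
  intro n hn
  rcases eq_or_ne (d n) 0 with hd | hd
  · rw [productTable, if_pos hd]
    refine ⟨fun j => ?_, fun j hj => Pi.single_eq_of_ne (by omega) _, ?_⟩
    · exact (Pi.single_nonneg (α := fun _ : ℕ => ℝ)).2 zero_le_one j
    · rw [sum_pi_single', if_pos (mem_range.2 (by omega))]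
  · refine ⟨fun j => ?_, fun j hj => ?_, ?_⟩
    · rw [productTable, if_neg hd]
      split_ifs
      exacts [mul_nonneg (h.seqT_nonneg j) (h.seqR_nonneg n), le_rfl]
    · rw [productTable, if_neg hd, if_neg hj.not_gt]
    · rw [← h.sum_seqT_mul_seqR hne hd]
      exact sum_congr rfl fun j hj => productTable_apply hd (mem_range.1 hj)

lemma IsFeasible.productTable_mem_tablesWith (h : IsFeasible d α)
    (hne : ∀ j, α j ≠ 0 → seqP d α (j + 1) ≠ 0) : productTable d α ∈ tablesWith d α := by
  refine ⟨h.productTable_mem_tables hne, fun j => ?_⟩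
  have hcol : ∀ n, d n * productTable d α n j =
      (if j < n then d n * seqR d α n else 0) * seqT d α j := fun n => by
    rcases eq_or_ne (d n) 0 with hd | hd
    · simp [hd]
    · rw [productTable, if_neg hd]
      split_ifs <;> ring
  simp only [hcol]
  rcases lt_or_ge j (firstIndex α) with hj | hj
  · simp [seqT_eq_div, eq_zero_of_lt_firstIndex hj]
  · exact seqP_mul_seqT hne j ▸ (h.hasSum_base_mul_seqR hj).mul_right _

end Weights

/-! ### Entropy of the rows -/

lemma sum_negMulLog_le_log_card {s : Finset ι} {q : ι → ℝ} (hq : ∀ i ∈ s, 0 ≤ q i)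
    (hsum : ∑ i ∈ s, q i = 1) : ∑ i ∈ s, Real.negMulLog (q i) ≤ Real.log s.card := by
  have hs : s.card ≠ 0 := fun h => by simp [card_eq_zero.1 h] at hsum
  have hjensen := Real.concaveOn_negMulLog.le_map_sum (t := s) (w := fun _ => (s.card : ℝ)⁻¹)
    (fun _ _ => by positivity) (by simp [hs]) hq
  simp only [smul_eq_mul, ← mul_sum, hsum, mul_one, Real.negMulLog, Real.log_inv] at hjensen
  field_simp at hjensen
  simpa [Real.negMulLog] using hjensen

lemma rowEntropy_nonneg {p : ℕ → ℕ → ℝ} (hp : p ∈ tables) {n : ℕ} (hn : 2 ≤ n) :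
    0 ≤ rowEntropy p n :=
  sum_nonneg fun j _ => Real.negMulLog_nonneg ((hp n hn).1 j)
    ((isStochastic_of_mem_tables hp hn).le_one j)

lemma rowEntropy_le_log {p : ℕ → ℕ → ℝ} (hp : p ∈ tables) {n : ℕ} (hn : 2 ≤ n) :
    rowEntropy p n ≤ Real.log n := by
  simpa [rowEntropy] using sum_negMulLog_le_log_card (fun j _ => (hp n hn).1 j) (hp n hn).2.2

section Entropy

variable {d α t r : ℕ → ℝ} {p : ℕ → ℕ → ℝ}

lemma base_mul_rowEntropy_nonneg (hd : ∀ n, 0 ≤ d n) (hbase : ∀ n, d n ≠ 0 → 2 ≤ n)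
    (hp : p ∈ tables) (n : ℕ) : 0 ≤ d n * rowEntropy p n := by
  rcases eq_or_ne (d n) 0 with h | h
  · simp [h]
  · exact mul_nonneg (hd n) (rowEntropy_nonneg hp (hbase n h))

lemma summable_base_mul_rowEntropy (hd : ∀ n, 0 ≤ d n) (hbase : ∀ n, d n ≠ 0 → 2 ≤ n)
    (hp : p ∈ tables) (hlog : Summable fun n : ℕ => d n * Real.log n) :
    Summable fun n => d n * rowEntropy p n := by
  refine hlog.of_nonneg_of_le (base_mul_rowEntropy_nonneg hd hbase hp) fun n => ?_
  rcases eq_or_ne (d n) 0 with h | h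
  · simp [h]
  · exact mul_le_mul_of_nonneg_left (rowEntropy_le_log hp (hbase n h)) (hd n)

lemma hasSum_base_mul_sum_row (hd : ∀ n, 0 ≤ d n) (hbase : ∀ n, d n ≠ 0 → 2 ≤ n)
    (hp : p ∈ tablesWith d α) {f : ℕ → ℝ} {s : ℝ} (hf : HasSum (fun j => α j * f j) s) :
    HasSum (fun n => d n * ∑ j ∈ range n, p n j * f j) s := by
  have hnonneg := mul_nonneg_of_mem_tables hd hbase hp.1
  have hcol : ∀ j, HasSum (fun n => ‖d n * p n j * f j‖) ‖α j * f j‖ := fun j => by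
    simp only [norm_mul, Real.norm_of_nonneg (hnonneg _ j),
      Real.norm_of_nonneg ((hp.2 j).nonneg fun n => hnonneg n j)]
    exact (hp.2 j).mul_right _
  have hsummable : Summable fun v : ℕ × ℕ => d v.2 * p v.2 v.1 * f v.1 := by
    refine summable_norm_iff.1 ((summable_prod_of_nonneg fun v => norm_nonneg _).2
      ⟨fun j => (hcol j).summable, ?_⟩)
    exact hf.summable.norm.congr fun j => (hcol j).tsum_eq.symm
  have htsum := (hsummable.hasSum.prod_fiberwise fun j => (hp.2 j).mul_right (f j)).unique hf
  have hswap := (Equiv.prodComm ℕ ℕ).hasSum_iff.2 (htsum ▸ hsummable.hasSum)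
  refine hswap.prod_fiberwise fun n => ?_
  rw [mul_sum]
  simp only [Function.comp_def, Equiv.prodComm_apply, Prod.swap, ← mul_assoc]
  refine hasSum_sum_of_ne_finset_zero fun j hj => ?_
  rcases eq_or_ne (d n) 0 with h | h
  · simp [h]
  · simp [(hp.1 n (hbase n h)).2.1 j (by simpa using hj)]

lemma base_mul_rowEntropy_eq (hbase : ∀ n, d n ≠ 0 → 2 ≤ n) (hp : p ∈ tables)
    (hr : ∀ n, d n ≠ 0 → r n ≠ 0)
    (hprod : ∀ n, d n ≠ 0 → ∀ j < n, p n j = t j * r n) (n : ℕ) :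
    d n * rowEntropy p n =
      -(d n * ∑ j ∈ range n, p n j * Real.log (t j)) - d n * Real.log (r n) := by
  rcases eq_or_ne (d n) 0 with h | h
  · simp [h]
  have hterm : ∀ j ∈ range n, Real.negMulLog (p n j) =
      -(p n j * Real.log (t j)) - p n j * Real.log (r n) := fun j hj => by
    rw [Real.negMulLog, hprod n h j (mem_range.1 hj)]
    rcases eq_or_ne (t j) 0 with ht | ht
    · simp [ht]
    · rw [Real.log_mul ht (hr n h)]
      ring
  rw [rowEntropy, sum_congr rfl hterm, sum_sub_distrib, sum_neg_distrib, ← sum_mul,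
    (hp n (hbase n h)).2.2]
  ring

lemma summable_base_mul_log (hd : ∀ n, 0 ≤ d n) (hbase : ∀ n, d n ≠ 0 → 2 ≤ n)
    (hp : p ∈ tablesWith d α) (hr : ∀ n, d n ≠ 0 → r n ≠ 0)
    (hprod : ∀ n, d n ≠ 0 → ∀ j < n, p n j = t j * r n)
    (hlog : Summable fun n : ℕ => d n * Real.log n)
    (ht : Summable fun j => α j * Real.log (t j)) :
    Summable fun n => d n * Real.log (r n) := by
  refine ((hasSum_base_mul_sum_row hd hbase hp ht.hasSum).summable.neg.sub
    (summable_base_mul_rowEntropy hd hbase hp.1 hlog)).congr fun n => ?_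
  rw [base_mul_rowEntropy_eq hbase hp.1 hr hprod]
  ring

lemma hasSum_base_mul_rowEntropy (hd : ∀ n, 0 ≤ d n) (hbase : ∀ n, d n ≠ 0 → 2 ≤ n)
    (hp : p ∈ tablesWith d α) (hr : ∀ n, d n ≠ 0 → r n ≠ 0)
    (hprod : ∀ n, d n ≠ 0 → ∀ j < n, p n j = t j * r n) {τ ρ : ℝ}
    (hτ : HasSum (fun j => α j * Real.log (t j)) τ)
    (hρ : HasSum (fun n => d n * Real.log (r n)) ρ) :
    HasSum (fun n => d n * rowEntropy p n) (-(τ + ρ)) := by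
  simp only [base_mul_rowEntropy_eq hbase hp.1 hr hprod]
  rw [neg_add']
  exact (hasSum_base_mul_sum_row hd hbase hp hτ).neg.sub hρ

end Entropy

/-! ### Truncated costs -/

/-- The cost of the digit `j` in the base `k`: it is `F j + G k` in the bases below `N`, and the
logarithm of the number of available digits in the others. -/
def truncCost (F G : ℕ → ℝ) (N k j : ℕ) : ℝ :=
  if k < N then F j + G k else Real.log k

/-- The function `F`, with the value `C` instead at the points of weight zero. The costs
`-log (t j)` and `-log (r k)` are modified in this way, as the logarithm of zero is `0` by
convention whereas a digit of weight zero has to be expensive. -/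
def penalize (w F : ℕ → ℝ) (C : ℝ) (j : ℕ) : ℝ := if w j = 0 then C else F j

/-- A bound for the mean of `truncCost F G N` along a digit sequence with digit frequencies `α`, if
the bases have the frequencies `d` and the mean of their logarithms is `L`. The last sum accounts
for the digits `j < N` in the bases `k ≥ N`. -/
def truncMean (d α F G : ℕ → ℝ) (L : ℝ) (N : ℕ) : ℝ :=
  L - ∑ k ∈ range N, d k * Real.log k + ∑ k ∈ range N, d k * G k + ∑ j ∈ range N, α j * F j +
    ∑ j ∈ range N, |F j| * min (α j) (1 - ∑ k ∈ range N, d k)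

section Penalize

variable {d α t r w F G : ℕ → ℝ}

lemma mul_penalize (C : ℝ) (j : ℕ) : w j * penalize w F C j = w j * F j := by
  rw [penalize]
  split_ifs with h <;> simp [h]

lemma tendsto_exp_neg_penalize (j : ℕ) :
    Tendsto (fun C => Real.exp (-penalize w F C j)) atTop
      (𝓝 (if w j = 0 then 0 else Real.exp (-F j))) := by
  simp only [penalize]
  split_ifs
  exacts [Real.tendsto_exp_neg_atTop_nhds_zero, tendsto_const_nhds]

lemma truncMean_penalize {N : ℕ} (hd : ∑ k ∈ range N, d k ≤ 1) (C : ℝ) (L : ℝ) :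
    truncMean d α (penalize α F C) (penalize d G C) L N = truncMean d α F G L N := by
  have hcross : ∀ j, |penalize α F C j| * min (α j) (1 - ∑ k ∈ range N, d k) =
      |F j| * min (α j) (1 - ∑ k ∈ range N, d k) := fun j => by
    rw [penalize]
    split_ifs with h
    · simp [h, hd]
    · rfl
  simp only [truncMean, mul_penalize, hcross]

/-- In the limit `C → ∞` only the weights `t j * r k` of the digits with `α j ≠ 0` remain. -/
lemma eventually_sum_exp_neg_penalize_le (ht0 : ∀ j, 0 ≤ t j)
    (ht : ∀ j, α j ≠ 0 → t j ≠ 0) (hr : ∀ n, d n ≠ 0 → 0 < r n) {k : ℕ}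
    (hsum : d k ≠ 0 → ∑ j ∈ range k, t j * r k = 1) {η : ℝ} (hη : 0 < η) :
    ∀ᶠ C in atTop, ∑ j ∈ range k, Real.exp
      (-(penalize α (fun j => -Real.log (t j)) C j + penalize d (fun k => -Real.log (r k)) C k)) ≤
        Real.exp η := by
  simp only [neg_add, Real.exp_add]
  have hlim := tendsto_finsetSum (range k) fun j _ =>
    (tendsto_exp_neg_penalize (w := α) (F := fun j => -Real.log (t j)) j).mul
      (tendsto_exp_neg_penalize (w := d) (F := fun k => -Real.log (r k)) k)
  refine (hlim.eventually_lt_const (lt_of_le_of_lt ?_ (Real.one_lt_exp_iff.2 hη))).mono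
    fun C hC => hC.le
  rcases eq_or_ne (d k) 0 with hk | hk
  · simp [hk]
  · rw [← hsum hk]
    refine sum_le_sum fun j _ => ?_
    rw [if_neg hk, neg_neg, neg_neg, Real.exp_log (hr k hk)]
    split_ifs with hj0
    · simpa using mul_nonneg (ht0 j) (hr k hk).le
    · rw [Real.exp_log ((ht0 j).lt_of_ne' (ht j hj0))]

lemma sum_exp_neg_log_card {k : ℕ} (hk : k ≠ 0) :
    ∑ _j ∈ range k, Real.exp (-Real.log k) = 1 := by
  have hk0 : (0 : ℝ) < k := by positivity
  simp [Real.exp_neg, Real.exp_log hk0, hk]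

lemma exists_sum_exp_neg_truncCost_le (ht0 : ∀ j, 0 ≤ t j)
    (ht : ∀ j, α j ≠ 0 → t j ≠ 0) (hr : ∀ n, d n ≠ 0 → 0 < r n)
    (hsum : ∀ k, d k ≠ 0 → ∑ j ∈ range k, t j * r k = 1) (N : ℕ) {η : ℝ} (hη : 0 < η) :
    ∃ C, ∀ k ≠ 0, ∑ j ∈ range k, Real.exp (-truncCost (penalize α (fun j => -Real.log (t j)) C)
      (penalize d (fun k => -Real.log (r k)) C) N k j) ≤ Real.exp η := by
  obtain ⟨C, hC⟩ := ((eventually_all_finset _).2 fun k (_ : k ∈ range N) =>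
    eventually_sum_exp_neg_penalize_le ht0 ht hr (hsum k) hη).exists
  refine ⟨C, fun k hk => ?_⟩
  by_cases hkN : k < N
  · simpa only [truncCost, if_pos hkN] using hC k (mem_range.2 hkN)
  · simpa only [truncCost, if_neg hkN, sum_exp_neg_log_card hk] using (Real.one_lt_exp_iff.2 hη).le

end Penalize

section MeanCost

variable {b ε : ℕ → ℕ} {d α F G : ℕ → ℝ}

lemma truncCost_le (N : ℕ) {k j : ℕ} (hj : j < k) :
    truncCost F G N k j ≤ Real.log k - (if k ∈ range N then Real.log k else 0) +
      (if k ∈ range N then G k else 0) + (if j ∈ range N then F j else 0) +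
        if k ∉ range N ∧ j ∈ range N then |F j| else 0 := by
  simp only [truncCost, mem_range]
  by_cases hk : k < N
  · simp only [hk, hj.trans hk, if_true, not_true, false_and, if_false]
    linarith
  · by_cases hjN : j < N
    · simp only [hk, hjN, if_true, if_false, not_false_eq_true, and_self]
      linarith [neg_abs_le (F j)]
    · simp [hk, hjN]

lemma sum_cross_le (b ε : ℕ → ℕ) (g : ℕ → ℝ) (K J : Finset ℕ) (n : ℕ) :
    ∑ i ∈ range n, (if b i ∉ K ∧ ε i ∈ J then |g (ε i)| else 0) ≤
      ∑ j ∈ J, |g j| * min (((range n).filter fun i => ε i = j).card : ℝ)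
        ((range n).filter fun i => b i ∉ K).card := by
  have hsplit : ∀ i, (if b i ∉ K ∧ ε i ∈ J then |g (ε i)| else 0) =
      ∑ j ∈ J, if b i ∉ K ∧ ε i = j then |g j| else 0 := fun i => by
    by_cases h : b i ∈ K <;> simp [h]
  simp only [hsplit]
  rw [sum_comm]
  refine sum_le_sum fun j _ => ?_
  rw [← sum_filter, sum_const, nsmul_eq_mul, mul_comm, ← Nat.cast_min]
  refine mul_le_mul_of_nonneg_left (Nat.cast_le.2 (le_min ?_ ?_)) (abs_nonneg _)
  · exact card_le_card (monotone_filter_right _ fun i _ h => h.2)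
  · exact card_le_card (monotone_filter_right _ fun i _ h => h.1)

lemma eventually_sum_truncCost_le (hd : HasFrequencies b d) (hε : HasFrequencies ε α)
    (hεb : ∀ i, ε i < b i) {L : ℝ}
    (hL : Tendsto (fun n : ℕ => (∑ i ∈ range n, Real.log (b i)) / n) atTop (𝓝 L))
    {N : ℕ} {c : ℝ} (hc : truncMean d α F G L N < c) :
    ∀ᶠ n : ℕ in atTop, ∑ i ∈ range n, truncCost F G N (b i) (ε i) ≤ n * c := by
  have hcross := tendsto_finsetSum (range N) fun j _ =>
    ((hε j).min (hd.tendsto_notMem (range N))).const_mul |F j|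
  have hlim := (((hL.sub (hd.tendsto_average (range N) fun k => Real.log k)).add
    (hd.tendsto_average (range N) G)).add (hε.tendsto_average (range N) F)).add hcross
  filter_upwards [hlim.eventually_lt_const hc, eventually_gt_atTop 0] with n hn hn0
  have hn' : (0 : ℝ) < n := Nat.cast_pos.2 hn0
  simp only [min_div_div_right hn'.le, ← mul_div_assoc, ← sum_div, ← sub_div, ← add_div] at hn
  rw [div_lt_iff₀' hn'] at hn
  refine le_trans ?_ ((add_le_add_right (sum_cross_le b ε F (range N) (range N) n) _).trans hn.le)
  simp only [← sum_sub_distrib, ← sum_add_distrib]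
  exact sum_le_sum fun i _ => truncCost_le N (hεb i)

lemma tendsto_sum_abs_mul_min (hα : ∀ j, 0 ≤ α j) (hF : Summable fun j => α j * F j)
    {δ : ℕ → ℝ} (hδ : ∀ N, 0 ≤ δ N) (hδ0 : Tendsto δ atTop (𝓝 0)) :
    Tendsto (fun N => ∑ j ∈ range N, |F j| * min (α j) (δ N)) atTop (𝓝 0) := by
  have hnonneg : ∀ N j, 0 ≤ |F j| * min (α j) (δ N) := fun N j =>
    mul_nonneg (abs_nonneg _) (le_min (hα j) (hδ N))
  have hle : ∀ N j, |F j| * min (α j) (δ N) ≤ ‖α j * F j‖ := fun N j => by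
    rw [norm_mul, Real.norm_of_nonneg (hα j), Real.norm_eq_abs, mul_comm]
    exact mul_le_mul_of_nonneg_right (min_le_left _ _) (abs_nonneg _)
  have hlim : Tendsto (fun N => ∑' j, |F j| * min (α j) (δ N)) atTop (𝓝 (∑' _ : ℕ, (0 : ℝ))) := by
    refine tendsto_tsum_of_dominated_convergence hF.norm (fun j => ?_) (.of_forall fun N j => ?_)
    · simpa [hα j] using ((tendsto_const_nhds (x := α j)).min hδ0).const_mul |F j|
    · rw [Real.norm_of_nonneg (hnonneg N j)]
      exact hle N j
  rw [tsum_zero] at hlim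
  exact squeeze_zero (fun N => sum_nonneg fun j _ => hnonneg N j) (fun N =>
    (hF.norm.of_nonneg_of_le (hnonneg N) (hle N)).sum_le_tsum _ fun j _ => hnonneg N j) hlim

lemma tendsto_truncMean (hd : IsStochastic d) (hα : ∀ j, 0 ≤ α j) {L σ ρ : ℝ}
    (hL : HasSum (fun n : ℕ => d n * Real.log n) L) (hF : HasSum (fun j => α j * F j) σ)
    (hG : HasSum (fun k => d k * G k) ρ) :
    Tendsto (truncMean d α F G L) atTop (𝓝 (σ + ρ)) := by
  have hδ : ∀ N, 0 ≤ 1 - ∑ k ∈ range N, d k := fun N =>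
    sub_nonneg.2 (sum_le_hasSum _ (fun k _ => hd.1 k) hd.2)
  have hδ0 : Tendsto (fun N => 1 - ∑ k ∈ range N, d k) atTop (𝓝 0) := by
    simpa using hd.2.tendsto_sum_nat.const_sub 1
  have hlim := (((hL.tendsto_sum_nat.const_sub L).add hG.tendsto_sum_nat).add
    hF.tendsto_sum_nat).add (tendsto_sum_abs_mul_min hα hF.summable hδ hδ0)
  rwa [sub_self, zero_add, add_zero, add_comm ρ] at hlim

end MeanCost

section UpperBound

variable {b : ℕ → ℕ} {d α t r : ℕ → ℝ}

theorem dimH_levelSet_le (hb : ∀ i, 0 < b i) (hd : HasFrequencies b d) (hd1 : HasSum d 1)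
    {L : ℝ} (hL0 : 0 < L) (hlog : HasSum (fun n : ℕ => d n * Real.log n) L)
    (hL : Tendsto (fun n : ℕ => (∑ i ∈ range n, Real.log (b i)) / n) atTop (𝓝 L))
    (hα : ∀ j, 0 ≤ α j) (ht0 : ∀ j, 0 ≤ t j) (ht : ∀ j, α j ≠ 0 → t j ≠ 0)
    (hr : ∀ n, d n ≠ 0 → 0 < r n)
    (hsum : ∀ k, d k ≠ 0 → ∑ j ∈ range k, t j * r k = 1) {τ ρ : ℝ}
    (hτ : HasSum (fun j => α j * Real.log (t j)) τ)
    (hρ : HasSum (fun n => d n * Real.log (r n)) ρ) :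
    dimH (levelSet b α) ≤ ENNReal.ofReal (-(τ + ρ) / L) := by
  have happrox : ∀ e > 0, dimH (levelSet b α) ≤ ENNReal.ofReal ((-(τ + ρ) + e + e) / L) := by
    intro e he
    have hmean := tendsto_truncMean ⟨hd.nonneg, hd1⟩ hα hlog
      (F := fun j => -Real.log (t j)) (by simpa using hτ.neg)
      (G := fun k => -Real.log (r k)) (by simpa using hρ.neg)
    rw [← neg_add] at hmean
    obtain ⟨N, hN⟩ := (hmean.eventually_lt_const (lt_add_of_pos_right _ he)).exists
    obtain ⟨C, hC⟩ := exists_sum_exp_neg_truncCost_le ht0 ht hr hsum N he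
    rw [← truncMean_penalize (hd.sum_le_one _) C] at hN
    refine (dimH_mono ?_).trans (dimH_le_of_cost hb hL0 hL (fun i => hC (b i) (hb i).ne')
      (E := {ε | (∀ i, ε i < b i) ∧ HasFrequencies ε α}) fun ε hε =>
        eventually_sum_truncCost_le hd hε.2 hε.1 hL hN)
    rintro x ⟨-, ε, hx, hε⟩
    exact ⟨ε, ⟨hx.1, hε⟩, hx⟩
  have hcont : Tendsto (fun e : ℝ => ENNReal.ofReal ((-(τ + ρ) + e + e) / L)) (𝓝[>] 0)
      (𝓝 (ENNReal.ofReal ((-(τ + ρ) + 0 + 0) / L))) :=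
    (ENNReal.tendsto_ofReal (Continuous.tendsto (by fun_prop) 0)).mono_left nhdsWithin_le_nhds
  rw [add_zero, add_zero] at hcont
  exact ge_of_tendsto hcont (eventually_mem_nhdsWithin.mono happrox)

end UpperBound

/-! ### The dimension of the level set -/

lemma log_two_le_of_tendsto_average {b : ℕ → ℕ} (hb : ∀ i, 2 ≤ b i) {L : ℝ}
    (hL : Tendsto (fun n : ℕ => (∑ i ∈ range n, Real.log (b i)) / n) atTop (𝓝 L)) :
    Real.log 2 ≤ L := by
  refine ge_of_tendsto hL ?_
  filter_upwards [eventually_gt_atTop 0] with n hn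
  rw [le_div_iff₀' (Nat.cast_pos.2 hn)]
  simpa using card_nsmul_le_sum (range n) (fun i => Real.log (b i)) (Real.log 2)
    fun i _ => Real.log_le_log two_pos (by exact_mod_cast hb i)

lemma tsum_nat_add_eq_tsum {f : ℕ → ℝ} {m : ℕ} (h0 : ∀ i < m, f i = 0) :
    ∑' i, f (m + i) = ∑' i, f i :=
  (add_right_injective m).tsum_eq fun i hi =>
    ⟨i - m, Nat.add_sub_of_le (not_lt.1 fun him => hi (h0 i him))⟩

section Dimension

variable {b : ℕ → ℕ} {d α : ℕ → ℝ}

lemma IsFeasible.summable_base_mul_log_seqR (h : IsFeasible d α)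
    (hne : ∀ j, α j ≠ 0 → seqP d α (j + 1) ≠ 0) (hbase : ∀ n, d n ≠ 0 → 2 ≤ n)
    (hlog : Summable fun n : ℕ => d n * Real.log n)
    (ht : Summable fun j => α j * Real.log (seqT d α j)) :
    Summable fun n => d n * Real.log (seqR d α n) :=
  summable_base_mul_log h.base.1 hbase (h.productTable_mem_tablesWith hne)
    (fun _ hn => (h.seqR_pos hne hn).ne') (fun _ hn _ => productTable_apply hn) hlog ht

theorem IsFeasible.dimH_levelSet (h : IsFeasible d α)
    (hne : ∀ j, α j ≠ 0 → seqP d α (j + 1) ≠ 0) (hb : ∀ i, 2 ≤ b i) (hd : HasFrequencies b d)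
    (hlog : Summable fun n : ℕ => d n * Real.log n)
    (hL : Tendsto (fun n : ℕ => (∑ i ∈ range n, Real.log (b i)) / n) atTop
      (𝓝 (∑' n : ℕ, d n * Real.log n)))
    (ht : Summable fun j => α j * Real.log (seqT d α j))
    (hr : Summable fun n => d n * Real.log (seqR d α n)) :
    ((dimH (levelSet b α) : ENNReal) : EReal) =
      ((-(∑' j, α j * Real.log (seqT d α j) + ∑' n, d n * Real.log (seqR d α n)) /
        ∑' n : ℕ, d n * Real.log n : ℝ) : EReal) := by
  have hbase : ∀ n, d n ≠ 0 → 2 ≤ n := fun n => base_ge_two_of_hasFrequencies hb hd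
  have hL0 := (Real.log_pos one_lt_two).trans_le (log_two_le_of_tendsto_average hb hL)
  have hp := h.productTable_mem_tablesWith hne
  have hent := hasSum_base_mul_rowEntropy h.base.1 hbase hp (fun n hn => (h.seqR_pos hne hn).ne')
    (fun n hn j => productTable_apply hn) ht.hasSum hr.hasSum
  have hle := dimH_levelSet_le (fun i => two_pos.trans_le (hb i)) hd h.base.2 hL0 hlog.hasSum hL
    h.digit.1 h.seqT_nonneg (fun j => seqT_ne_zero hne) (fun n => h.seqR_pos hne)
    (fun n => h.sum_seqT_mul_seqR hne) ht.hasSum hr.hasSum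
  rw [hle.antisymm (le_dimH_levelSet hb hd h.base.2 hL0 hL hp hent), EReal.coe_ennreal_ofReal,
    max_eq_left]
  exact div_nonneg (hent.nonneg (base_mul_rowEntropy_nonneg h.base.1 hbase hp.1)) hL0.le

end Dimension

end CantorSeries

end

theorem mainTheorem1 (b : ℕ → ℕ) (hb : ∀ i, 2 ≤ b i)
    (d : ℕ → ℝ) (hd : CantorSeries.IsBaseFrequency b d) (hd1 : HasSum d 1)
    (hlog : Summable (fun n : ℕ => d n * Real.log n))
    (hmean : Tendsto (fun n : ℕ => (∑ i ∈ Finset.range n, Real.log (b i)) / n) atTop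
      (𝓝 (∑' n : ℕ, d n * Real.log n)))
    (α : ℕ → ℝ) (hα : CantorSeries.IsStochastic α)
    (hπ : (CantorSeries.tablesWith d α).Nonempty)
    (hden : ∀ j, α j ≠ 0 → ∀ k ∈ Finset.Icc (CantorSeries.firstIndex α + 1) j,
      CantorSeries.seqA d α k ≠ 0 ∧ 1 - d k / CantorSeries.seqA d α k ≠ 0)
    (hsum : Summable (fun j : ℕ => α (CantorSeries.firstIndex α + j) *
      Real.log (CantorSeries.seqT d α (CantorSeries.firstIndex α + j)))) :
    Summable (fun i : ℕ => d (CantorSeries.firstIndex α + 1 + i) *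
      Real.log (CantorSeries.seqR d α (CantorSeries.firstIndex α + 1 + i))) ∧
    ((dimH (CantorSeries.levelSet b α) : ENNReal) : EReal) =
      ((-((∑' j : ℕ, α (CantorSeries.firstIndex α + j) *
              Real.log (CantorSeries.seqT d α (CantorSeries.firstIndex α + j))) +
            ∑' i : ℕ, d (CantorSeries.firstIndex α + 1 + i) *
              Real.log (CantorSeries.seqR d α (CantorSeries.firstIndex α + 1 + i))) /
          ∑' n : ℕ, d n * Real.log n : ℝ) : EReal) := by
  obtain ⟨p, hp⟩ := hπ
  have hbase : ∀ n, d n ≠ 0 → 2 ≤ n := fun n =>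
    CantorSeries.base_ge_two_of_hasFrequencies hb hd
  have h : CantorSeries.IsFeasible d α := CantorSeries.isFeasible_of_mem_tablesWith
    ⟨CantorSeries.HasFrequencies.nonneg hd, hd1⟩ hbase hα hp
  have hne : ∀ j, α j ≠ 0 → CantorSeries.seqP d α (j + 1) ≠ 0 := fun j hj =>
    CantorSeries.seqP_add_one_ne_zero fun k hk => (hden j hj k hk).2
  have ht : Summable fun j => α j * Real.log (CantorSeries.seqT d α j) :=
    (summable_nat_add_iff (CantorSeries.firstIndex α)).1 (by simpa only [add_comm] using hsum)
  have hr := h.summable_base_mul_log_seqR hne hbase hlog ht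
  refine ⟨by simpa only [add_comm] using
    (summable_nat_add_iff (CantorSeries.firstIndex α + 1)).2 hr, ?_⟩
  rw [CantorSeries.tsum_nat_add_eq_tsum (f := fun j => α j * Real.log (CantorSeries.seqT d α j))
      fun j hj => by rw [CantorSeries.eq_zero_of_lt_firstIndex hj, zero_mul],
    CantorSeries.tsum_nat_add_eq_tsum (f := fun n => d n * Real.log (CantorSeries.seqR d α n))
      fun n hn => by rw [h.base_eq_zero (Nat.lt_succ_iff.1 hn), zero_mul]]
  exact h.dimH_levelSet hne hb hd hlog hmean ht hr
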